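/- Let $0\le r\le n$ be integers and let $[n]=\{1,\dots,n\}$. Let $$A^*(U_{n,n})=\frac{\mathbb Z[x_S:\emptyset\ne S\subseteq[n]]}{\langle x_Sx_T: S\not\subseteq T,\ T\not\subseteq S\rangle+\langle\sum_{S\ni e}x_S: e\in[n]\rangle}$$ be the Chow ring of the free matroid on $[n]$, on which the symmetric group $S_n$ acts by $\sigma(x_S)=x_{\sigma(S)}$. For the uniform matroid $U_{r,n}$ of rank $r$ on $[n]$, with rank function $\mathrm{rk}$, let the rank-nullity ring $R^*(U_{r,n})\subseteq A^*(U_{n,n})$ be the subring generated by the elements $$y_{i,j}=\sum_{\emptyset\ne S\subseteq[n],\ \mathrm{rk}(S)=i,\ |S|-\mathrm{rk}(S)=j}x_S\qquad(0\le i,j\le n).$$ For $1\le l\le n$ let $z_l=\sum_{S\subseteq[n],\,|S|=l}x_S$. For $0\le a<b\le n$ let $$g_{a,b}=Z_a\cdot\sum_{i=b}^n\binom{i-a-1}{b-a-1}(Z_i+Z_{i+1}+\dots+Z_n)^{b-a}\in\mathbb Z[Z_1,\dots,Z_n],$$ with the convention $Z_0=1$, and let $\mathcal I\subseteq\mathbb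 Z[Z_1,\dots,Z_n]$ be the ideal generated by all the $g_{a,b}$. Theorem. (1) $R^*(U_{r,n})=A^*(U_{n,n})^{S_n}$. (2) There is a ring isomorphism $\mathbb Z[Z_1,\dots,Z_n]/\mathcal I\cong R^*(U_{r,n})$ that sends the class of $Z_i$ to $z_i$ for each $1\le i\le n$. (3) For every monomial order $\succ$ with $Z_1\succ Z_2\succ\dots\succ Z_n$, the leading term of $g_{a,b}$ is $Z_aZ_b^{b-a}$ for all $0\le a<b\le n$, and the polynomials $g_{a,b}$ form a Gröbner basis of $\mathcal I$, i.e. their leading terms generate the ideal generated by the leading terms (with coefficients) of all elements of $\mathcal I$. -/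

import Mathlib

open scoped MonomialOrder

namespace RankNullity

/-- The uniform matroid `U_{r,n}` on the `n`-element ground set `Fin n`: a set is independent
iff it has at most `r` elements. -/
def uniform (r n : ℕ) : Matroid (Fin n) :=
  (IndepMatroid.ofFinite (E := Set.univ) Set.finite_univ (fun I => I.ncard ≤ r)
    (by simp)
    (fun I J hJ hIJ => (Set.ncard_le_ncard hIJ (Set.toFinite J)).trans hJ)
    (fun I J hI hJ hIJ => by
      obtain ⟨e, heJ, heI⟩ := Set.exists_mem_notMem_of_ncard_lt_ncard hIJ (Set.toFinite I)
      refine ⟨e, heJ, heI, ?_⟩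
      rw [Set.ncard_insert_of_notMem heI (Set.toFinite I)]
      omega)
    (fun I _ => Set.subset_univ I)).matroid

theorem uniform_indep_iff {r n : ℕ} {I : Set (Fin n)} :
    (uniform r n).Indep I ↔ I.ncard ≤ r := Iff.rfl

/-- Every subset is a flat of the free matroid `U_{n,n}`. -/
theorem isFlat_free {n : ℕ} (S : Set (Fin n)) : (uniform n n).IsFlat S := by
  have hall : ∀ I : Set (Fin n), (uniform n n).Indep I := fun I => by
    rw [uniform_indep_iff]
    simpa using Set.ncard_le_card I
  refine ⟨fun I X hIS hIX => ?_, Set.subset_univ S⟩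
  have h1 : I = S := hIS.eq_of_subset_indep (hall S) hIS.subset subset_rfl
  have h2 : I = X := hIX.eq_of_subset_indep (hall X) hIX.subset subset_rfl
  exact (h2.symm.trans h1).subset

variable {n : ℕ}

/-- The nonempty flats of a matroid. -/
abbrev NonemptyFlat (M : Matroid (Fin n)) : Type :=
  {F : Set (Fin n) // M.IsFlat F ∧ F.Nonempty}

open Classical in
/-- The ideal of relations of the Chow ring of a matroid `M`, generated by `x_F x_G` for
incomparable nonempty flats `F`, `G` and by `∑_{F ∋ e} x_F` for `e` in the ground set. -/
noncomputable def chowIdeal (M : Matroid (Fin n)) : Ideal (MvPolynomial (NonemptyFlat M) ℤ) :=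
  Ideal.span {p | ∃ F G : NonemptyFlat M, ¬ F.1 ⊆ G.1 ∧ ¬ G.1 ⊆ F.1 ∧
      p = MvPolynomial.X F * MvPolynomial.X G} ⊔
  Ideal.span {p | ∃ e ∈ M.E, p = ∑ F : NonemptyFlat M with e ∈ F.1, MvPolynomial.X F}

/-- The Chow ring `A^*(M)` of a matroid. -/
abbrev ChowRing (M : Matroid (Fin n)) : Type :=
  MvPolynomial (NonemptyFlat M) ℤ ⧸ chowIdeal M

/-- The Chow ring `A^*(U_{n,n})` of the free matroid on `n` elements. -/
abbrev FreeChow (n : ℕ) : Type := ChowRing (uniform n n)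

/-- The nonempty subsets of the ground set. -/
abbrev NonemptySubset (n : ℕ) : Type := {S : Set (Fin n) // S.Nonempty}

/-- The generator `x_S` of `A^*(U_{n,n})`. -/
noncomputable def x (S : NonemptySubset n) : FreeChow n :=
  Ideal.Quotient.mk _ (MvPolynomial.X ⟨S.1, isFlat_free S.1, S.2⟩)

/-- The rank function of a matroid on `Fin n`, with natural number values. -/
noncomputable def rank (M : Matroid (Fin n)) (S : Set (Fin n)) : ℕ := (M.eRk S).toNat

/-- The nullity `|S| - rank(S)`; the subtraction never truncates, as `rank(S) ≤ |S|`. -/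
noncomputable def nullity (M : Matroid (Fin n)) (S : Set (Fin n)) : ℕ := S.ncard - rank M S

open Classical in
/-- `y_{i,j}`: the sum of the `x_S` over the nonempty `S` of rank `i` and nullity `j` in `M`. -/
noncomputable def y (M : Matroid (Fin n)) (i j : ℕ) : FreeChow n :=
  ∑ S : NonemptySubset n with rank M S.1 = i ∧ nullity M S.1 = j, x S

/-- The rank-nullity ring `R^*(M)` of a matroid `M` with ground set `Fin n`: the subring of
`A^*(U_{n,n})` generated by the `y_{i,j}`. -/
noncomputable def rankNullityRing (M : Matroid (Fin n)) : Subring (FreeChow n) :=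
  Subring.closure {f | ∃ i j : ℕ, i ≤ n ∧ j ≤ n ∧ f = y M i j}

open Classical in
/-- `z_l`: the sum of the `x_S` over the subsets `S` with `l ≥ 1` elements. -/
noncomputable def z (n l : ℕ) : FreeChow n :=
  ∑ S : NonemptySubset n with S.1.ncard = l, x S

/-- The permutation of the nonempty flats of `U_{n,n}` induced by a permutation of `Fin n`. -/
def mapFlat (σ : Equiv.Perm (Fin n)) (F : NonemptyFlat (uniform n n)) :
    NonemptyFlat (uniform n n) :=
  ⟨σ '' F.1, isFlat_free _, F.2.2.image σ⟩

theorem chowIdeal_le_comap (σ : Equiv.Perm (Fin n)) :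
    chowIdeal (uniform n n) ≤ (chowIdeal (uniform n n)).comap
      (MvPolynomial.rename (R := ℤ) (mapFlat σ)).toRingHom := by
  classical
  refine sup_le (Ideal.span_le.2 ?_) (Ideal.span_le.2 ?_)
  · rintro p ⟨F, G, h1, h2, rfl⟩
    refine Ideal.mem_sup_left (Ideal.subset_span ⟨mapFlat σ F, mapFlat σ G, ?_, ?_, ?_⟩)
    · simpa [mapFlat, Set.image_subset_image_iff σ.injective] using h1
    · simpa [mapFlat, Set.image_subset_image_iff σ.injective] using h2
    · simp
  · rintro p ⟨e, -, rfl⟩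
    refine Ideal.mem_sup_right (Ideal.subset_span ⟨σ e, Set.mem_univ _, ?_⟩)
    simp only [AlgHom.toRingHom_eq_coe, RingHom.coe_coe, map_sum, MvPolynomial.rename_X]
    refine Finset.sum_bij' (fun F _ => mapFlat σ F) (fun F _ => mapFlat σ.symm F) ?_ ?_ ?_ ?_ ?_
    · intro F hF
      simpa [mapFlat] using hF
    · intro F hF
      simpa [mapFlat] using hF
    · intro F _
      exact Subtype.ext (by simp [mapFlat, Set.image_image])
    · intro F _
      exact Subtype.ext (by simp [mapFlat, Set.image_image])
    · intro F _
      rfl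

/-- The action of a permutation `σ` of `Fin n` on `A^*(U_{n,n})`, by `x_S ↦ x_{σ(S)}`. -/
noncomputable def permAct (σ : Equiv.Perm (Fin n)) : FreeChow n →+* FreeChow n :=
  Ideal.quotientMap _ (MvPolynomial.rename (R := ℤ) (mapFlat σ)).toRingHom (chowIdeal_le_comap σ)

theorem permAct_x (σ : Equiv.Perm (Fin n)) (S : NonemptySubset n) :
    permAct σ (x S) = x ⟨σ '' S.1, S.2.image σ⟩ := by
  simp [permAct, x, mapFlat]

/-- The ring of invariants `A^*(U_{n,n})^{S_n}`. -/
noncomputable def permInvariants (n : ℕ) : Subring (FreeChow n) where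
  carrier := {f | ∀ σ : Equiv.Perm (Fin n), permAct σ f = f}
  mul_mem' hf hg σ := by rw [map_mul, hf σ, hg σ]
  one_mem' σ := map_one _
  add_mem' hf hg σ := by rw [map_add, hf σ, hg σ]
  zero_mem' σ := map_zero _
  neg_mem' hf σ := by rw [map_neg, hf σ]

/-- The variable `Z_i` of `ℤ[Z_1, …, Z_n]` for `1 ≤ i ≤ n`, with `Z_0 = 1`. As the variables are
indexed by `Fin n`, `Z_{i+1}` is the variable with index `i`. Not used for `i > n`. -/
noncomputable def Z (n : ℕ) : ℕ → MvPolynomial (Fin n) ℤ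
  | 0 => 1
  | i + 1 => if h : i < n then MvPolynomial.X ⟨i, h⟩ else 0

/-- The polynomial
`Z_a · ∑_{i=b}^n binom(i-a-1, b-a-1) (Z_i + Z_{i+1} + ⋯ + Z_n)^{b-a}`, used for `a < b ≤ n`. -/
noncomputable def gen (n a b : ℕ) : MvPolynomial (Fin n) ℤ :=
  Z n a * ∑ i ∈ Finset.Icc b n,
    ((i - a - 1).choose (b - a - 1) : MvPolynomial (Fin n) ℤ) *
      (∑ j ∈ Finset.Icc i n, Z n j) ^ (b - a)

/-- The set of the polynomials `gen n a b` for `0 ≤ a < b ≤ n`. -/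
def genSet (n : ℕ) : Set (MvPolynomial (Fin n) ℤ) :=
  {p | ∃ a b : ℕ, a < b ∧ b ≤ n ∧ p = gen n a b}

/-- The ideal generated by the polynomials `gen n a b` for `0 ≤ a < b ≤ n`. -/
noncomputable def relIdeal (n : ℕ) : Ideal (MvPolynomial (Fin n) ℤ) := Ideal.span (genSet n)

/-- `G` is a Gröbner basis of `I` for the monomial order `m`: a finite subset of `I` whose leading
terms (with their coefficients) generate the ideal generated by the leading terms of all elements
of `I`. -/
def IsGroebnerBasis {σ : Type*} {R : Type*} [CommRing R] (m : MonomialOrder σ)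
    (G : Set (MvPolynomial σ R)) (I : Ideal (MvPolynomial σ R)) : Prop :=
  G.Finite ∧ G ⊆ I ∧ Ideal.span (m.leadingTerm '' G) = Ideal.span (m.leadingTerm '' (I : Set _))

end RankNullity

namespace RankNullity

open MvPolynomial

/-! A permutation `σ` gives a complete flag of nonempty subsets, and `restrict σ` keeps only the
variables of that flag. A monomial supported on a chain lies on some flag, so a polynomial with zero
restriction to every flag vanishes wherever products of incomparable variables do. Identities modulo
those products can therefore be checked one flag at a time, inside ℤ[Z_1, …, Z_n].

The basic such identity is x_F ∏_{e ∈ G∖F} (∑_{S⊇G} x_S − θ_e) = 0 for F ⊂ G, with θ_e = ∑_{S∋e}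
x_S. If the θ_e become constants, it rewrites x_F x_G^{|G∖F|} in terms of monomials of smaller
weight. Hence the Feichtner–Yuzvinsky standard monomials span the Chow ring (θ_e = 0) and also a
deformation of it (θ_e = e + 1), realised as functions on the n! permutations. There are at most n!
standard monomials and they span that n!-dimensional space, so they are independent in the
deformation. Comparing degrees carries independence over to the Chow ring
(`eq_zero_of_aeval_faceClass_eq_zero`).

Uniqueness of standard representatives makes the representative of an invariant class invariant. It
then has the same restriction to every flag, so its class is a polynomial in the z_l; for a uniform
matroid the nonzero y_{i,j} are exactly the z_l. This gives (1).

With θ_e = 0, summing the basic relations over all F ⊂ G of sizes a and b gives an element whose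
restriction to every flag is g_{a,b}; so g_{a,b} vanishes at the z_l. Conversely, a polynomial with
no monomial divisible by any Z_a Z_b^{b-a} spreads out to a combination of standard monomials, so it
is zero if it vanishes at the z_l. Division by the monic g_{a,b} thus leaves remainder zero on the
kernel of evaluation, which yields the presentation and the Gröbner basis together. -/

/-- The nonempty finite subsets of `Fin n`. -/
abbrev Face (n : ℕ) : Type := {S : Finset (Fin n) // S.Nonempty}

/-! ### Restriction to complete flags -/

section Restriction

variable {n : ℕ}

/-- The initial segment of a permutation, up to and including position `i`. -/
def seg (σ : Equiv.Perm (Fin n)) (i : Fin n) : Face n :=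
  ⟨(Finset.Iic i).map σ.toEmbedding, by simp⟩

theorem mem_seg {σ : Equiv.Perm (Fin n)} {i e : Fin n} : e ∈ (seg σ i).1 ↔ σ.symm e ≤ i := by
  simp only [seg, Finset.mem_map_equiv, Finset.mem_Iic]

theorem card_seg (σ : Equiv.Perm (Fin n)) (i : Fin n) : (seg σ i).1.card = i + 1 := by
  simp [seg]

theorem seg_subset_seg {σ : Equiv.Perm (Fin n)} {i j : Fin n} :
    (seg σ i).1 ⊆ (seg σ j).1 ↔ i ≤ j := by
  simp [seg]

theorem seg_injective (σ : Equiv.Perm (Fin n)) : Function.Injective (seg σ) := by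
  intro i j h
  exact le_antisymm (seg_subset_seg.1 (congrArg Subtype.val h).subset)
    (seg_subset_seg.1 (congrArg Subtype.val h).superset)

/-- The restriction of a polynomial in the `x_S` to the flag of a permutation. -/
noncomputable def restrict (σ : Equiv.Perm (Fin n)) :
    MvPolynomial (Face n) ℤ →ₐ[ℤ] MvPolynomial (Fin n) ℤ :=
  killCompl (seg_injective σ)

theorem restrict_X_seg (σ : Equiv.Perm (Fin n)) (i : Fin n) :
    restrict σ (X (seg σ i)) = X i := by
  rw [← rename_X (R := ℤ) (seg σ) i]
  exact killCompl_rename_app _ _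

theorem restrict_X_of_ne {σ : Equiv.Perm (Fin n)} {S : Face n} (h : ∀ i, seg σ i ≠ S) :
    restrict σ (X S) = 0 := by
  simp [restrict, killCompl, h]

theorem restrict_sum_X (σ : Equiv.Perm (Fin n)) (p : Face n → Prop) [DecidablePred p] :
    restrict σ (∑ S with p S, X S) = ∑ i with p (seg σ i), X i := by
  classical
  rw [map_sum]
  symm
  refine Finset.sum_of_injOn (seg σ) (seg_injective σ).injOn ?_ ?_ ?_
  · intro i hi
    simpa using hi
  · intro S _ hS
    refine restrict_X_of_ne fun i hi => hS ⟨i, ?_, hi⟩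
    subst hi
    simp_all
  · intro i _
    exact (restrict_X_seg σ i).symm

/-- The support of the exponent is a chain of subsets. -/
def HasChainSupport (m : Face n →₀ ℕ) : Prop :=
  ∀ S ∈ m.support, ∀ T ∈ m.support, S.1 ⊆ T.1 ∨ T.1 ⊆ S.1

theorem hasChainSupport_mapDomain (σ : Equiv.Perm (Fin n)) (q : Fin n →₀ ℕ) :
    HasChainSupport (q.mapDomain (seg σ)) := by
  classical
  intro S hS T hT
  obtain ⟨i, _, rfl⟩ := Finset.mem_image.1 (Finsupp.mapDomain_support hS)
  obtain ⟨j, _, rfl⟩ := Finset.mem_image.1 (Finsupp.mapDomain_support hT)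
  simpa only [seg_subset_seg] using le_total i j

theorem exists_seg_eq {σ : Equiv.Perm (Fin n)} {S : Face n}
    (h : ∀ e ∈ S.1, ∀ e', σ.symm e' ≤ σ.symm e → e' ∈ S.1) : ∃ i, seg σ i = S := by
  obtain ⟨e, he, hmax⟩ := S.1.exists_max_image σ.symm S.2
  refine ⟨σ.symm e, Subtype.ext (Finset.ext fun e' => ?_)⟩
  rw [mem_seg]
  exact ⟨h e he e', hmax e'⟩

theorem HasChainSupport.exists_perm {m : Face n →₀ ℕ} (hm : HasChainSupport m) :
    ∃ (σ : Equiv.Perm (Fin n)) (q : Fin n →₀ ℕ), q.mapDomain (seg σ) = m := by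
  classical
  -- Sorting by the number of members of the chain that miss an element puts the elements of each
  -- member S strictly before those outside S, so S is an initial segment.
  let f : Fin n → ℕ := fun e => (m.support.filter fun S => e ∉ S.1).card
  refine ⟨Tuple.sort f, m.comapDomain (seg _) (seg_injective _).injOn,
    Finsupp.mapDomain_comapDomain _ (seg_injective _) _ ?_⟩
  intro S hS
  refine exists_seg_eq fun e he e' hle => ?_
  by_contra he'
  have hmono := Tuple.monotone_sort f hle
  simp only [Function.comp_apply, Equiv.apply_symm_apply] at hmono
  refine absurd hmono (not_le.2 (Finset.card_lt_card ?_))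
  refine Finset.ssubset_iff_of_subset ?_ |>.2 ⟨S, by simpa [he'] using hS, by simp [he]⟩
  intro T hT
  simp only [Finset.mem_filter] at hT ⊢
  refine ⟨hT.1, fun h => ?_⟩
  rcases hm S hS T hT.1 with h1 | h1
  · exact hT.2 (h1 he)
  · exact he' (h1 h)

theorem coeff_restrict (σ : Equiv.Perm (Fin n)) (f : MvPolynomial (Face n) ℤ) (q : Fin n →₀ ℕ) :
    (restrict σ f).coeff q = f.coeff (q.mapDomain (seg σ)) :=
  coeff_killCompl _

theorem prod_pow_eq_zero_of_not_hasChainSupport {B : Type*} [CommRing B] {x : Face n → B}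
    (hx : ∀ S T : Face n, ¬ S.1 ⊆ T.1 → ¬ T.1 ⊆ S.1 → x S * x T = 0)
    {m : Face n →₀ ℕ} (hm : ¬ HasChainSupport m) : (m.prod fun S k => x S ^ k) = 0 := by
  classical
  simp only [HasChainSupport, not_forall, not_or] at hm
  obtain ⟨S, hS, T, hT, h1, h2⟩ := hm
  have hne : T ≠ S := by rintro rfl; exact h1 subset_rfl
  have hST := Finset.mem_erase.2 ⟨hne, hT⟩
  rw [Finsupp.prod, ← Finset.mul_prod_erase _ _ hS, ← Finset.mul_prod_erase _ _ hST,
    ← mul_assoc]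
  obtain ⟨a, ha⟩ := Nat.exists_eq_succ_of_ne_zero (Finsupp.mem_support_iff.1 hS)
  obtain ⟨b, hb⟩ := Nat.exists_eq_succ_of_ne_zero (Finsupp.mem_support_iff.1 hT)
  rw [ha, hb, pow_succ, pow_succ]
  linear_combination (x S ^ a * x T ^ b *
    ∏ U ∈ (m.support.erase S).erase T, x U ^ m U) * hx S T h1 h2

/-- A polynomial that restricts to zero on all flags vanishes whenever the products of
incomparable variables do. -/
theorem aeval_eq_zero_of_restrict_eq_zero {B : Type*} [CommRing B] [Algebra ℤ B] {x : Face n → B}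
    (hx : ∀ S T : Face n, ¬ S.1 ⊆ T.1 → ¬ T.1 ⊆ S.1 → x S * x T = 0)
    {f : MvPolynomial (Face n) ℤ} (hf : ∀ σ, restrict σ f = 0) : aeval x f = 0 := by
  rw [aeval_def, eval₂_eq']
  refine Finset.sum_eq_zero fun m _ => ?_
  -- The coefficient of a chain monomial is a coefficient of the restriction to a flag through it;
  -- any other monomial has value zero by `hx`.
  by_cases hm : HasChainSupport m
  · obtain ⟨σ, q, rfl⟩ := hm.exists_perm
    rw [← coeff_restrict, hf]
    simp
  · have := prod_pow_eq_zero_of_not_hasChainSupport hx hm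
    rw [Finsupp.prod_fintype _ _ (by simp)] at this
    rw [this, mul_zero]

/-- The linear form `∑_{S ∋ e} x_S`. -/
noncomputable def theta (e : Fin n) : MvPolynomial (Face n) ℤ := ∑ S : Face n with e ∈ S.1, X S

/-- The linear form `∑_{S ⊇ G} x_S`. -/
noncomputable def above (G : Finset (Fin n)) : MvPolynomial (Face n) ℤ :=
  ∑ S : Face n with G ⊆ S.1, X S

/-- The variable `x_F`, with `x_∅ = 1`. -/
noncomputable def faceVar (F : Finset (Fin n)) : MvPolynomial (Face n) ℤ :=
  if h : F.Nonempty then X ⟨F, h⟩ else 1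

theorem restrict_theta (σ : Equiv.Perm (Fin n)) (e : Fin n) :
    restrict σ (theta e) = ∑ i with σ.symm e ≤ i, X i := by
  simp only [theta, restrict_sum_X, mem_seg]

theorem restrict_above (σ : Equiv.Perm (Fin n)) (G : Finset (Fin n)) :
    restrict σ (above G) = ∑ i with (∀ e ∈ G, σ.symm e ≤ i), X i := by
  simp only [above, restrict_sum_X, Finset.subset_iff, mem_seg]

theorem restrict_above_of_max (σ : Equiv.Perm (Fin n)) {G : Finset (Fin n)} {g : Fin n}
    (hg : g ∈ G) (hmax : ∀ e ∈ G, σ.symm e ≤ σ.symm g) :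
    restrict σ (above G) = ∑ i with σ.symm g ≤ i, X i := by
  rw [restrict_above]
  refine Finset.sum_congr (Finset.filter_congr fun i _ => ?_) fun _ _ => rfl
  exact ⟨fun h => h g hg, fun h e he => (hmax e he).trans h⟩

/-- Let g be the element of G that comes last in the flag. If g ∈ F, then F is not an initial
segment, since it omits an earlier element of G, and x_F restricts to zero. Otherwise a flag member
contains G exactly when it contains g, so the factor for e = g restricts to zero. -/
theorem restrict_faceVar_mul_prod {F G : Finset (Fin n)} (hFG : F ⊂ G)
    (σ : Equiv.Perm (Fin n)) :
    restrict σ (faceVar F * ∏ e ∈ G \ F, (above G - theta e)) = 0 := by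
  obtain ⟨g₀, hg₀, hg₀F⟩ := Finset.exists_of_ssubset hFG
  obtain ⟨g, hg, hmax⟩ := G.exists_max_image σ.symm ⟨g₀, hg₀⟩
  by_cases hgF : g ∈ F
  · have hF : F.Nonempty := ⟨g, hgF⟩
    rw [map_mul, faceVar, dif_pos hF, restrict_X_of_ne, zero_mul]
    rintro i hi
    have h1 : g ∈ (seg σ i).1 := by rw [hi]; exact hgF
    have h2 : g₀ ∉ (seg σ i).1 := by rw [hi]; exact hg₀F
    rw [mem_seg] at h1 h2
    exact h2 ((hmax g₀ hg₀).trans h1)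
  · rw [map_mul, map_prod, Finset.prod_eq_zero (Finset.mem_sdiff.2 ⟨hg, hgF⟩), mul_zero]
    rw [map_sub, restrict_theta, restrict_above_of_max σ hg hmax, sub_self]

end Restriction

/-! ### Straightening into standard monomials -/

section Reduction

variable {n : ℕ} (R : Type*) {B : Type*} [CommRing R] [CommRing B] [Algebra R B] (x : Face n → B)

/-- The value of the monomial with exponent `q` at the family `x`. -/
noncomputable def monomialValue (q : Face n →₀ ℕ) : B := q.prod fun S k => x S ^ k

theorem monomialValue_add (q q' : Face n →₀ ℕ) :
    monomialValue x (q + q') = monomialValue x q * monomialValue x q' :=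
  Finsupp.prod_add_index' (fun _ => pow_zero _) fun _ _ _ => pow_add _ _ _

theorem monomialValue_zero : monomialValue x 0 = 1 := Finsupp.prod_zero_index

theorem monomialValue_single (S : Face n) (k : ℕ) :
    monomialValue x (Finsupp.single S k) = x S ^ k :=
  Finsupp.prod_single_index (pow_zero _)

/-- The weight of a variable, strictly decreasing in the subset. -/
def faceWeight (S : Face n) : ℕ := n + 1 - S.1.card

theorem faceWeight_pos (S : Face n) : 0 < faceWeight S := by
  have := card_finset_fin_le S.1
  unfold faceWeight
  omega

theorem faceWeight_lt {S T : Face n} (h : S.1 ⊂ T.1) : faceWeight T < faceWeight S := by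
  have := card_finset_fin_le T.1
  have := Finset.card_lt_card h
  unfold faceWeight
  omega

/-- The span of the values of the monomials of degree at most `d` and weight less than `w`. -/
noncomputable def boundedSpan (d w : ℕ) : Submodule R B :=
  Submodule.span R {b | ∃ q : Face n →₀ ℕ, q.degree ≤ d ∧ Finsupp.weight faceWeight q < w ∧
    monomialValue x q = b}

variable {R x}

theorem monomialValue_mem_boundedSpan {q : Face n →₀ ℕ} {d w : ℕ} (hd : q.degree ≤ d)
    (hw : Finsupp.weight faceWeight q < w) : monomialValue x q ∈ boundedSpan R x d w :=
  Submodule.subset_span ⟨q, hd, hw, rfl⟩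

theorem var_mem_boundedSpan {S : Face n} {w : ℕ} (hw : faceWeight S < w) :
    x S ∈ boundedSpan R x 1 w := by
  rw [← pow_one (x S), ← monomialValue_single]
  exact monomialValue_mem_boundedSpan (by simp) (by simpa [Finsupp.weight_single] using hw)

theorem algebraMap_mem_boundedSpan (r : R) {d w : ℕ} (hw : 0 < w) :
    algebraMap R B r ∈ boundedSpan R x d w := by
  rw [Algebra.algebraMap_eq_smul_one, ← monomialValue_zero x]
  exact Submodule.smul_mem _ _ (monomialValue_mem_boundedSpan (by simp) (by simpa using hw))

/-- Weight bounds are strict, so one factor may attain weight w' and the product still stays below w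
+ w'. -/
theorem mul_mem_boundedSpan {a b : B} {d d' w w' : ℕ} (ha : a ∈ boundedSpan R x d w)
    (hb : b ∈ boundedSpan R x d' (w' + 1)) : a * b ∈ boundedSpan R x (d + d') (w + w') := by
  have h := Submodule.mul_mem_mul ha hb
  rw [boundedSpan, boundedSpan, Submodule.span_mul_span] at h
  refine Submodule.span_le.2 ?_ h
  rintro _ ⟨_, ⟨q, h1, h2, rfl⟩, _, ⟨q', h3, h4, rfl⟩, rfl⟩
  simp only [← monomialValue_add]
  refine monomialValue_mem_boundedSpan ?_ ?_
  · rw [map_add]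
    omega
  · rw [map_add]
    omega

/-- Expanding the product, every term other than the pure power of a contains some c e, whose weight
is lower. The first conclusion is the bound that the induction for the second one needs. -/
theorem pow_sub_prod_mem_boundedSpan {ι : Type*} {a : B} {c : ι → B} {w : ℕ}
    (ha : a ∈ boundedSpan R x 1 (w + 1)) (hc : ∀ e, c e ∈ boundedSpan R x 1 w) (E : Finset ι) :
    ∏ e ∈ E, (a + c e) ∈ boundedSpan R x E.card (E.card * w + 1) ∧
    a ^ E.card - ∏ e ∈ E, (a + c e) ∈ boundedSpan R x E.card (E.card * w) := by
  classical
  induction E using Finset.induction_on with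
  | empty => simpa using algebraMap_mem_boundedSpan (x := x) (d := 0) (1 : R) one_pos
  | insert e E he ih =>
    obtain ⟨h1, h2⟩ := ih
    have hmono : boundedSpan R x 1 w ≤ boundedSpan R x 1 (w + 1) :=
      Submodule.span_mono fun b ⟨q, h1, h2, h3⟩ => ⟨q, h1, h2.trans (Nat.lt_succ_self _), h3⟩
    rw [Finset.prod_insert he, Finset.card_insert_of_notMem he]
    constructor
    · have := mul_mem_boundedSpan (add_mem ha (hmono (hc e))) h1
      convert this using 2 <;> ring
    · have h3 := mul_mem_boundedSpan h2 ha
      have h4 := mul_mem_boundedSpan (hc e) h1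
      have h5 : a ^ (E.card + 1) - (a + c e) * ∏ e ∈ E, (a + c e) =
        (a ^ E.card - ∏ e ∈ E, (a + c e)) * a - c e * ∏ e ∈ E, (a + c e) := by ring
      rw [h5]
      refine sub_mem ?_ ?_
      · convert h3 using 2; ring
      · convert h4 using 2 <;> ring

/-- The exponents of the standard monomials. -/
structure IsStandard (m : Face n →₀ ℕ) : Prop where
  chain : HasChainSupport m
  lt_card : ∀ S ∈ m.support, m S < S.1.card
  add_card_lt_card : ∀ S ∈ m.support, ∀ T ∈ m.support, T.1 ⊂ S.1 → m S + T.1.card < S.1.card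

variable (R x) in
/-- The span of the values of the standard monomials of degree at most `d`. -/
noncomputable def standardSpan (d : ℕ) : Submodule R B :=
  Submodule.span R {b | ∃ q : Face n →₀ ℕ, IsStandard q ∧ q.degree ≤ d ∧ monomialValue x q = b}

/-- The exponent of `faceVar F`. -/
noncomputable def faceExp (F : Finset (Fin n)) : Face n →₀ ℕ :=
  if h : F.Nonempty then Finsupp.single ⟨F, h⟩ 1 else 0

theorem monomialValue_faceExp [Algebra ℤ B] (F : Finset (Fin n)) :
    monomialValue x (faceExp F) = aeval x (faceVar F) := by
  unfold faceExp faceVar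
  split_ifs <;> simp [monomialValue_single, monomialValue_zero]

/-- A nonstandard chain monomial is divisible by the leading monomial x_F x_G^{|G∖F|} of a basic
relation; F = ∅ accounts for the condition on a single exponent. -/
theorem HasChainSupport.exists_of_not_isStandard {m : Face n →₀ ℕ} (hm : HasChainSupport m)
    (h : ¬ IsStandard m) : ∃ (F : Finset (Fin n)) (G : Face n) (m₀ : Face n →₀ ℕ), F ⊂ G.1 ∧
      m = m₀ + faceExp F + Finsupp.single G (G.1 \ F).card := by
  classical
  have h' : (∃ S ∈ m.support, S.1.card ≤ m S) ∨
      ∃ S ∈ m.support, ∃ T ∈ m.support, T.1 ⊂ S.1 ∧ S.1.card ≤ m S + T.1.card := by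
    by_contra! hcon
    exact h ⟨hm, hcon.1, hcon.2⟩
  rcases h' with ⟨S, hS, hle⟩ | ⟨S, hS, T, hT, hTS, hle⟩
  · refine ⟨∅, S, m - Finsupp.single S S.1.card, Finset.empty_ssubset.2 S.2, ?_⟩
    simp only [faceExp, Finset.not_nonempty_empty, dite_false, add_zero, Finset.sdiff_empty]
    refine (tsub_add_cancel_of_le ?_).symm
    rwa [Finsupp.single_le_iff]
  · refine ⟨T.1, S, m - (faceExp T.1 + Finsupp.single S (S.1 \ T.1).card), hTS, ?_⟩
    rw [add_assoc]
    refine (tsub_add_cancel_of_le ?_).symm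
    have hcard : (S.1 \ T.1).card ≤ m S := by
      rw [Finset.card_sdiff_of_subset hTS.subset]
      omega
    have hne : T ≠ S := by rintro rfl; exact hTS.ne rfl
    intro U
    simp only [faceExp, T.2, dite_true, Finsupp.add_apply, Finsupp.single_apply]
    have hT1 : 1 ≤ m T := Nat.one_le_iff_ne_zero.2 (Finsupp.mem_support_iff.1 hT)
    rcases eq_or_ne T U with rfl | h1
    · simpa [hne.symm] using hT1
    · rcases eq_or_ne S U with rfl | h2
      · simpa [h1] using hcard
      · simp [h1, h2]

variable [Algebra ℤ B] {p : Fin n → R}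

/-- One rewriting step by a basic relation: it strictly lowers the weight and does not raise the
degree. -/
theorem monomialValue_mem_boundedSpan_of_not_isStandard
    (hx : ∀ S T : Face n, ¬ S.1 ⊆ T.1 → ¬ T.1 ⊆ S.1 → x S * x T = 0)
    (hp : ∀ e, aeval x (theta e) = algebraMap R B (p e))
    {m : Face n →₀ ℕ} (hm : HasChainSupport m) (h : ¬ IsStandard m) :
    monomialValue x m ∈ boundedSpan R x m.degree (Finsupp.weight faceWeight m) := by
  classical
  obtain ⟨F, G, m₀, hFG, rfl⟩ := hm.exists_of_not_isStandard h
  have hrel := aeval_eq_zero_of_restrict_eq_zero hx (restrict_faceVar_mul_prod hFG)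
  have hab : aeval x (above G.1) = x G + ∑ S : Face n with G.1 ⊂ S.1, x S := by
    rw [above, map_sum, ← Finset.add_sum_erase _ _ (a := G) (by simp)]
    simp only [aeval_X]
    congr 1
    refine Finset.sum_congr ?_ fun _ _ => rfl
    ext S
    simp only [Finset.mem_erase, Finset.mem_filter, Finset.mem_univ, true_and,
      Finset.ssubset_iff_subset_ne, ne_eq, Subtype.ext_iff, eq_comm (a := S.1), and_comm]
  -- What remains of each factor after x_G: variables of strictly larger sets and a constant. Both
  -- have weight below that of x_G, as weights of variables are positive.
  let c : Fin n → B := fun e => (∑ S : Face n with G.1 ⊂ S.1, x S) - algebraMap R B (p e)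
  have hc : ∀ e, c e ∈ boundedSpan R x 1 (faceWeight G) := fun e =>
    sub_mem (Submodule.sum_mem _ fun S hS =>
      var_mem_boundedSpan (faceWeight_lt (Finset.mem_filter.1 hS).2))
      (algebraMap_mem_boundedSpan _ (faceWeight_pos G))
  have key := (pow_sub_prod_mem_boundedSpan (var_mem_boundedSpan (R := R) (x := x)
    (Nat.lt_succ_self (faceWeight G))) hc (G.1 \ F)).2
  have hrel' : monomialValue x (faceExp F) * ∏ e ∈ G.1 \ F, (x G + c e) = 0 := by
    rw [map_mul, map_prod, ← monomialValue_faceExp] at hrel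
    rw [← hrel]
    congr 1
    refine Finset.prod_congr rfl fun e _ => ?_
    rw [map_sub, hab, hp, add_sub_assoc]
  have heq : monomialValue x (m₀ + faceExp F + Finsupp.single G (G.1 \ F).card) =
      (x G ^ (G.1 \ F).card - ∏ e ∈ G.1 \ F, (x G + c e)) * monomialValue x (m₀ + faceExp F) := by
    rw [monomialValue_add, monomialValue_single, monomialValue_add]
    linear_combination monomialValue x m₀ * hrel'
  rw [heq]
  have := mul_mem_boundedSpan key (monomialValue_mem_boundedSpan (R := R) (x := x)
    (le_refl (m₀ + faceExp F).degree) (Nat.lt_succ_self _))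
  convert this using 2
  · rw [map_add _ (m₀ + faceExp F), Finsupp.degree_single, add_comm]
  · rw [map_add _ (m₀ + faceExp F), Finsupp.weight_single, add_comm, smul_eq_mul]

/-- Every monomial is a combination of standard monomials of no larger degree. -/
theorem monomialValue_mem_standardSpan
    (hx : ∀ S T : Face n, ¬ S.1 ⊆ T.1 → ¬ T.1 ⊆ S.1 → x S * x T = 0)
    (hp : ∀ e, aeval x (theta e) = algebraMap R B (p e)) {m : Face n →₀ ℕ} {d : ℕ}
    (hd : m.degree ≤ d) : monomialValue x m ∈ standardSpan R x d := by
  suffices H : ∀ w, boundedSpan R x d w ≤ standardSpan R x d from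
    H _ (monomialValue_mem_boundedSpan hd (Nat.lt_succ_self _))
  intro w
  induction w with
  | zero =>
    refine Submodule.span_le.2 ?_
    rintro _ ⟨q, _, h, _⟩
    exact absurd h (Nat.not_lt_zero _)
  | succ w ih =>
    refine Submodule.span_le.2 ?_
    rintro _ ⟨q, h1, h2, rfl⟩
    by_cases hq : HasChainSupport q
    · by_cases hs : IsStandard q
      · exact Submodule.subset_span ⟨q, hs, h1, rfl⟩
      · refine ih (Submodule.span_mono ?_
          (monomialValue_mem_boundedSpan_of_not_isStandard hx hp hq hs))
        rintro _ ⟨q', h3, h4, rfl⟩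
        exact ⟨q', h3.trans h1, h4.trans_le (Nat.lt_succ_iff.1 h2), rfl⟩
    · have : monomialValue x q = 0 := prod_pow_eq_zero_of_not_hasChainSupport hx hq
      rw [SetLike.mem_coe, this]
      exact zero_mem _

end Reduction

/-! ### There are at most n! standard monomials -/

section Counting

variable {n : ℕ}

theorem IsStandard.erase {m : Face n →₀ ℕ} (hm : IsStandard m) (G : Face n) :
    IsStandard (m.erase G) := by
  classical
  have hsub : ∀ S ∈ (m.erase G).support, S ∈ m.support ∧ m.erase G S = m S := by
    intro S hS
    rw [Finsupp.support_erase, Finset.mem_erase] at hS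
    exact ⟨hS.2, Finsupp.erase_ne hS.1⟩
  refine ⟨fun S hS T hT => hm.chain S (hsub S hS).1 T (hsub T hT).1, fun S hS => ?_,
    fun S hS T hT h => ?_⟩
  · rw [(hsub S hS).2]
    exact hm.lt_card S (hsub S hS).1
  · rw [(hsub S hS).2]
    exact hm.add_card_lt_card S (hsub S hS).1 T (hsub T hT).1 h

open Classical in
/-- A finite set containing the standard exponents whose support has largest member `S`. -/
noncomputable def standardTop (S : Finset (Fin n)) : Finset (Face n →₀ ℕ) :=
  if h : S.Nonempty then
    S.ssubsets.attach.biUnion fun F =>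
      (Finset.Ico 1 (S.card - F.1.card) ×ˢ standardTop F.1).image fun dm =>
        dm.2 + Finsupp.single ⟨S, h⟩ dm.1
  else {0}
termination_by S.card
decreasing_by exact Finset.card_lt_card (Finset.mem_ssubsets.1 F.2)

theorem card_standardTop_le {S : Finset (Fin n)} (h : S.Nonempty) :
    (standardTop S).card ≤ ∑ F ∈ S.ssubsets, (S.card - F.card - 1) * (standardTop F).card := by
  classical
  rw [standardTop, dif_pos h, ← Finset.sum_attach]
  refine Finset.card_biUnion_le.trans (Finset.sum_le_sum fun F _ => ?_)
  refine Finset.card_image_le.trans ?_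
  rw [Finset.card_product, Nat.card_Ico]

/-- Write t(F) for the size of `standardTop F`. Since t(S) ≤ ∑_{F⊂S} (|S|−|F|−1) t(F), the total
over subsets of S is at most ∑_{F⊂S} |S∖F| t(F) = ∑_{e∈S} ∑_{F⊆S∖e} t(F), which induction bounds by
|S| · (|S|−1)!. -/
theorem sum_card_standardTop_le (S : Finset (Fin n)) :
    ∑ F ∈ S.powerset, (standardTop F).card ≤ S.card.factorial := by
  classical
  induction S using Finset.strongInduction with
  | H S ih =>
    rcases S.eq_empty_or_nonempty with rfl | h
    · rw [Finset.powerset_empty, Finset.sum_singleton, standardTop, dif_neg (by simp)]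
      simp
    · have h1 : ∑ F ∈ S.powerset, (standardTop F).card =
          (standardTop S).card + ∑ F ∈ S.ssubsets, (standardTop F).card :=
        (Finset.add_sum_erase _ _ (Finset.mem_powerset_self S)).symm
      have h2 : ∀ F ∈ S.ssubsets, (S.card - F.card - 1) * (standardTop F).card +
          (standardTop F).card = ∑ e ∈ S, if e ∉ F then (standardTop F).card else 0 := by
        intro F hF
        have hFS := Finset.mem_ssubsets.1 hF
        have hlt := Finset.card_lt_card hFS
        rw [← Finset.sum_filter, Finset.sum_const, Finset.filter_notMem_eq_sdiff,
          Finset.card_sdiff_of_subset hFS.subset, smul_eq_mul, ← Nat.succ_mul]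
        congr 1
        omega
      have h3 : ∀ e ∈ S, ∑ F ∈ S.ssubsets, (if e ∉ F then (standardTop F).card else 0) ≤
          (S.card - 1).factorial := by
        intro e he
        rw [← Finset.sum_filter, ← Finset.card_erase_of_mem he]
        refine le_trans (Finset.sum_le_sum_of_subset ?_) (ih _ (Finset.erase_ssubset he))
        intro F hF
        rw [Finset.mem_filter, Finset.mem_ssubsets] at hF
        exact Finset.mem_powerset.2 (Finset.subset_erase.2 ⟨hF.1.subset, hF.2⟩)
      calc ∑ F ∈ S.powerset, (standardTop F).card
          ≤ ∑ F ∈ S.ssubsets, ((S.card - F.card - 1) * (standardTop F).card +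
              (standardTop F).card) := by
            rw [h1, Finset.sum_add_distrib]
            exact Nat.add_le_add_right (card_standardTop_le h) _
        _ = ∑ e ∈ S, ∑ F ∈ S.ssubsets, (if e ∉ F then (standardTop F).card else 0) := by
            rw [Finset.sum_congr rfl h2, Finset.sum_comm]
        _ ≤ ∑ e ∈ S, (S.card - 1).factorial := Finset.sum_le_sum h3
        _ = S.card.factorial := by
            rw [Finset.sum_const, smul_eq_mul, Nat.mul_factorial_pred h.card_ne_zero]

/-- Peel off the largest set S of the chain. With F the next largest, or ∅ if there is none,
standardness confines the exponent of S to 1, …, |S|−|F|−1. -/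
theorem IsStandard.mem_standardTop {m : Face n →₀ ℕ} (hm : IsStandard m) {S : Finset (Fin n)}
    (hle : ∀ T ∈ m.support, T.1 ⊆ S) (hmem : ∀ h : S.Nonempty, (⟨S, h⟩ : Face n) ∈ m.support) :
    m ∈ standardTop S := by
  classical
  induction S using Finset.strongInduction generalizing m with
  | H S ih =>
    rw [standardTop]
    split_ifs with h
    · set G : Face n := ⟨S, h⟩
      have hG := hmem h
      obtain ⟨F, hF, hd, hFle, hFmem⟩ : ∃ F : Finset (Fin n), F ⊂ S ∧ m G + F.card < S.card ∧
          (∀ T ∈ (m.erase G).support, T.1 ⊆ F) ∧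
          ∀ h : F.Nonempty, (⟨F, h⟩ : Face n) ∈ (m.erase G).support := by
        rcases (m.erase G).support.eq_empty_or_nonempty with h0 | h0
        · exact ⟨∅, Finset.empty_ssubset.2 h, by simpa using hm.lt_card G hG,
            by rw [h0]; simp, by simp⟩
        · obtain ⟨F, hF, hmax⟩ := Finset.exists_max_image _ (fun T : Face n => T.1.card) h0
          have hF' := hF
          rw [Finsupp.support_erase, Finset.mem_erase] at hF'
          have hFS : F.1 ⊂ S := (hle F hF'.2).ssubset_of_ne fun h => hF'.1 (Subtype.ext h)
          refine ⟨F.1, hFS, hm.add_card_lt_card G hG F hF'.2 hFS, fun T hT => ?_, fun _ => hF⟩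
          rcases (hm.erase G).chain T hT F hF with h1 | h1
          · exact h1
          · rw [Finset.eq_of_subset_of_card_le h1 (hmax T hT)]
      refine Finset.mem_biUnion.2 ⟨⟨F, Finset.mem_ssubsets.2 hF⟩, Finset.mem_attach _ _,
        Finset.mem_image.2 ⟨(m G, m.erase G), Finset.mem_product.2 ⟨Finset.mem_Ico.2 ⟨?_, ?_⟩,
          ih F hF (hm.erase G) hFle hFmem⟩, Finsupp.erase_add_single G m⟩⟩
      · exact Nat.one_le_iff_ne_zero.2 (Finsupp.mem_support_iff.1 hG)
      · exact lt_tsub_iff_right.2 hd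
    · rw [Finset.mem_singleton, ← Finsupp.support_eq_empty, Finset.eq_empty_iff_forall_notMem]
      exact fun T hT => h (T.2.mono (hle T hT))

open Classical in
theorem IsStandard.mem_biUnion {m : Face n →₀ ℕ} (hm : IsStandard m) :
    m ∈ (Finset.univ.powerset : Finset (Finset (Fin n))).biUnion standardTop := by
  rcases m.support.eq_empty_or_nonempty with h0 | h0
  · exact Finset.mem_biUnion.2 ⟨∅, by simp, hm.mem_standardTop (by simp [h0]) (by simp)⟩
  · obtain ⟨F, hF, hmax⟩ := Finset.exists_max_image _ (fun T : Face n => T.1.card) h0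
    refine Finset.mem_biUnion.2 ⟨F.1, by simp, hm.mem_standardTop (fun T hT => ?_) fun _ => hF⟩
    rcases hm.chain T hT F hF with h1 | h1
    · exact h1
    · rw [Finset.eq_of_subset_of_card_le h1 (hmax T hT)]

instance finite_isStandard : Finite {m : Face n →₀ ℕ // IsStandard m} := by
  classical
  exact Set.Finite.subset (Finset.finite_toSet _) fun m (hm : IsStandard m) => hm.mem_biUnion

theorem card_isStandard_le : Nat.card {m : Face n →₀ ℕ // IsStandard m} ≤ n.factorial := by
  classical
  have h : {m : Face n →₀ ℕ | IsStandard m} ⊆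
      ((Finset.univ.powerset : Finset (Finset (Fin n))).biUnion standardTop : Finset _) :=
    fun m (hm : IsStandard m) => hm.mem_biUnion
  calc Nat.card {m : Face n →₀ ℕ // IsStandard m}
      = Set.ncard {m : Face n →₀ ℕ | IsStandard m} := rfl
    _ ≤ _ := Set.ncard_le_ncard h (Finset.finite_toSet _)
    _ = _ := Set.ncard_coe_finset _
    _ ≤ _ := Finset.card_biUnion_le
    _ ≤ _ := sum_card_standardTop_le _
    _ = n.factorial := by simp

end Counting

/-! ### The deformation as functions on n! points -/

section Points

variable {n : ℕ}

/-- The coordinate at position `k` of the point with coordinates `1, …, n` permuted by `σ`,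
extended by zero. -/
def coordAt (σ : Equiv.Perm (Fin n)) (k : ℕ) : ℚ := if h : k < n then (σ ⟨k, h⟩ : ℚ) + 1 else 0

/-- The difference of consecutive coordinates of a permuted point. -/
def gap (σ : Equiv.Perm (Fin n)) (i : Fin n) : ℚ := coordAt σ i - coordAt σ (i + 1)

theorem gap_ne_zero (σ : Equiv.Perm (Fin n)) (i : Fin n) : gap σ i ≠ 0 := by
  unfold gap coordAt
  rw [dif_pos i.2]
  split_ifs with h
  · intro h0
    have h1 : σ i = σ ⟨i + 1, h⟩ := by
      refine Fin.ext ?_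
      have h2 : ((σ i : ℕ) : ℚ) = ((σ ⟨i + 1, h⟩ : ℕ) : ℚ) := by linarith
      exact_mod_cast h2
    have h3 := congrArg Fin.val (σ.injective h1)
    simp at h3
  · rw [sub_zero]
    positivity

theorem sum_gap (σ : Equiv.Perm (Fin n)) (a : Fin n) : ∑ i with a ≤ i, gap σ i = σ a + 1 := by
  have key : ∀ (f : ℕ → ℚ) (a N : ℕ), a ≤ N →
      ∑ k ∈ Finset.range N, (if a ≤ k then f k - f (k + 1) else 0) = f a - f N := by
    intro f a N h
    induction N, h using Nat.le_induction with
    | base =>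
      rw [sub_self]
      exact Finset.sum_eq_zero fun k hk => if_neg (by simpa using hk)
    | succ N h ih =>
      rw [Finset.sum_range_succ, ih, if_pos h]
      ring
  have h := key (coordAt σ) a n a.2.le
  rw [← Fin.sum_univ_eq_sum_range
    (fun k => if (a : ℕ) ≤ k then coordAt σ k - coordAt σ (k + 1) else 0)] at h
  rw [Finset.sum_filter]
  simp only [Fin.le_def, gap]
  rw [h]
  simp [coordAt]

/-- The values of the variable `x_S` at the points permuting `(1, …, n)`. -/
noncomputable def pointValue (S : Face n) (σ : Equiv.Perm (Fin n)) : ℚ :=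
  aeval (gap σ) (restrict σ (X S))

theorem aeval_pointValue (f : MvPolynomial (Face n) ℤ) (σ : Equiv.Perm (Fin n)) :
    aeval pointValue f σ = aeval (gap σ) (restrict σ f) := by
  have h : (Pi.evalAlgHom ℤ (fun _ : Equiv.Perm (Fin n) => ℚ) σ).comp (aeval pointValue) =
      (aeval (gap σ)).comp (restrict σ) := by
    ext S
    simp [pointValue]
  exact DFunLike.congr_fun h f

theorem pointValue_mul_eq_zero (S T : Face n) (h1 : ¬ S.1 ⊆ T.1) (h2 : ¬ T.1 ⊆ S.1) :
    pointValue S * pointValue T = 0 := by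
  funext σ
  by_cases hS : ∃ i, seg σ i = S
  · by_cases hT : ∃ i, seg σ i = T
    · obtain ⟨i, rfl⟩ := hS
      obtain ⟨j, rfl⟩ := hT
      rw [seg_subset_seg] at h1 h2
      exact absurd (le_total i j) (by tauto)
    · simp [pointValue, restrict_X_of_ne (not_exists.1 hT)]
  · simp [pointValue, restrict_X_of_ne (not_exists.1 hS)]

/-- The gaps telescope to the coordinate of e at the permuted point, which is e + 1 whatever the
permutation; so θ_e acts as a scalar and the straightening applies. -/
theorem aeval_pointValue_theta (e : Fin n) :
    aeval pointValue (theta e) = algebraMap ℚ (Equiv.Perm (Fin n) → ℚ) (e + 1) := by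
  funext σ
  rw [aeval_pointValue, restrict_theta, map_sum]
  simp only [aeval_X, sum_gap, Equiv.apply_symm_apply, Pi.algebraMap_apply,
    Algebra.algebraMap_self, RingHom.id_apply]

theorem perm_eq_of_seg {σ τ : Equiv.Perm (Fin n)} (h : ∀ i, ∃ j, seg τ j = seg σ i) : τ = σ := by
  have h' : ∀ i, seg τ i = seg σ i := by
    intro i
    obtain ⟨j, hj⟩ := h i
    have h1 : (seg τ j).1.card = (seg σ i).1.card := by rw [hj]
    rw [card_seg, card_seg] at h1
    rwa [Fin.ext (Nat.succ_injective h1)] at hj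
  have h2 : ∀ e, τ.symm e = σ.symm e := by
    intro e
    refine eq_of_forall_ge_iff fun i => ?_
    rw [← mem_seg, ← mem_seg, h' i]
  rw [← τ.symm_symm, ← σ.symm_symm, Equiv.ext h2]

/-- A flag determines its permutation, so the product along it is supported at one point; it is
nonzero there because the coordinates are distinct and positive. -/
theorem prod_pointValue (σ : Equiv.Perm (Fin n)) :
    ∏ i, pointValue (seg σ i) = Pi.single σ (∏ i, gap σ i) := by
  funext τ
  rw [Finset.prod_apply]
  rcases eq_or_ne τ σ with rfl | h
  · simp [pointValue, restrict_X_seg]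
  · rw [Pi.single_eq_of_ne h]
    have : ∃ i, ∀ j, seg τ j ≠ seg σ i := by
      by_contra! hcon
      exact h (perm_eq_of_seg hcon)
    obtain ⟨i, hi⟩ := this
    exact Finset.prod_eq_zero (Finset.mem_univ i) (by simp [pointValue, restrict_X_of_ne hi])

theorem span_pointValue : (⊤ : Submodule ℚ (Equiv.Perm (Fin n) → ℚ)) ≤
    Submodule.span ℚ (Set.range fun q : {q : Face n →₀ ℕ // IsStandard q} =>
      monomialValue pointValue q.1) := by
  classical
  intro f _
  rw [← Finset.univ_sum_single f]
  refine Submodule.sum_mem _ fun σ _ => ?_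
  have h1 : (Pi.single σ (f σ) : Equiv.Perm (Fin n) → ℚ) =
      (f σ / ∏ i, gap σ i) • ∏ i, pointValue (seg σ i) := by
    rw [prod_pointValue, ← Pi.single_smul, smul_eq_mul,
      div_mul_cancel₀ _ (Finset.prod_ne_zero_iff.2 fun i _ => gap_ne_zero σ i)]
  have h2 : ∏ i, pointValue (seg σ i) =
      monomialValue pointValue (∑ i, Finsupp.single (seg σ i) 1) := by
    have : ∀ s : Finset (Fin n), ∏ i ∈ s, pointValue (seg σ i) =
        monomialValue pointValue (∑ i ∈ s, Finsupp.single (seg σ i) 1) := by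
      intro s
      induction s using Finset.induction_on with
      | empty => simp [monomialValue_zero]
      | insert i s hi ih =>
        rw [Finset.prod_insert hi, Finset.sum_insert hi, monomialValue_add,
          monomialValue_single, pow_one, ih]
    exact this _
  rw [h1, h2]
  refine Submodule.smul_mem _ _ (Submodule.span_mono ?_
    (monomialValue_mem_standardSpan pointValue_mul_eq_zero aeval_pointValue_theta le_rfl))
  rintro _ ⟨q, hq, _, rfl⟩
  exact ⟨⟨q, hq⟩, rfl⟩

/-- The standard monomials are linearly independent as functions on the points. -/
theorem linearIndependent_pointValue :
    LinearIndependent ℚ fun q : {q : Face n →₀ ℕ // IsStandard q} =>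
      monomialValue pointValue q.1 := by
  classical
  have := Fintype.ofFinite {q : Face n →₀ ℕ // IsStandard q}
  rw [linearIndependent_iff_card_le_finrank_span, Set.finrank, top_le_iff.1 span_pointValue,
    finrank_top, Module.finrank_fintype_fun_eq_card, Fintype.card_perm, Fintype.card_fin,
    ← Nat.card_eq_fintype_card]
  exact card_isStandard_le

end Points

/-! ### Standard monomials form a basis of the Chow ring -/

section ChowBasis

variable {n : ℕ}

/-- The graded deformation sending `x_S` to its point values times the formal variable. -/
noncomputable def gradedPointValue :
    MvPolynomial (Face n) ℤ →ₐ[ℤ] Polynomial (Equiv.Perm (Fin n) → ℚ) :=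
  aeval fun S => Polynomial.C (pointValue S) * Polynomial.X

/-- The span of the point values of the monomials of degree less than `d`. -/
noncomputable def lowerSpan (n d : ℕ) : Submodule ℚ (Equiv.Perm (Fin n) → ℚ) :=
  Submodule.span ℚ (monomialValue pointValue '' {q | q.degree < d})

theorem pointValue_mul_mem_lowerSpan (S : Face n) {d : ℕ} {v : Equiv.Perm (Fin n) → ℚ}
    (hv : v ∈ lowerSpan n d) : pointValue S * v ∈ lowerSpan n (d + 1) := by
  have h : lowerSpan n d ≤ (lowerSpan n (d + 1)).comap (LinearMap.mulLeft ℚ (pointValue S)) := by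
    refine Submodule.span_le.2 ?_
    rintro _ ⟨q, hq, rfl⟩
    refine Submodule.subset_span ⟨Finsupp.single S 1 + q, ?_, ?_⟩
    · simp only [Set.mem_ofPred_eq, map_add, Finsupp.degree_single] at hq ⊢
      omega
    · rw [monomialValue_add, monomialValue_single, pow_one]
      rfl
  exact h hv

/-- The polynomials whose degree `d` component has point values in the span of the monomials of
degree less than `d`, for all `d`. -/
noncomputable def degenerateIdeal (n : ℕ) : Ideal (MvPolynomial (Face n) ℤ) where
  carrier := {f | ∀ d, (gradedPointValue f).coeff d ∈ lowerSpan n d}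
  add_mem' hf hg d := by
    rw [map_add, Polynomial.coeff_add]
    exact add_mem (hf d) (hg d)
  zero_mem' d := by simp
  smul_mem' c f hf := by
    simp only [smul_eq_mul, Set.mem_ofPred_eq] at hf ⊢
    induction c using MvPolynomial.induction_on with
    | C a =>
      intro d
      rw [← smul_eq_C_mul, map_smul, Polynomial.coeff_smul]
      exact zsmul_mem (hf d) a
    | add p q hp hq =>
      intro d
      rw [add_mul, map_add, Polynomial.coeff_add]
      exact add_mem (hp d) (hq d)
    | mul_X p S hp =>
      intro d
      have h : gradedPointValue (p * X S * f) =
          Polynomial.C (pointValue S) * gradedPointValue (p * f) * Polynomial.X := by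
        rw [map_mul, map_mul, map_mul]
        simp only [gradedPointValue, aeval_X]
        ring
      rw [h]
      cases d with
      | zero => simp
      | succ d =>
        rw [Polynomial.coeff_mul_X, Polynomial.coeff_C_mul]
        exact pointValue_mul_mem_lowerSpan S (hp d)

theorem gradedPointValue_monomial (m : Face n →₀ ℕ) (a : ℤ) :
    gradedPointValue (monomial m a) =
      Polynomial.monomial m.degree (a • monomialValue pointValue m) := by
  rw [gradedPointValue, aeval_monomial, Finsupp.degree_apply]
  simp only [mul_pow, Finsupp.prod, Finset.prod_mul_distrib]
  simp only [← map_pow, ← map_prod, Finset.prod_pow_eq_pow_sum]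
  rw [← mul_assoc, ← Polynomial.C_mul_X_pow_eq_monomial, monomialValue, Finsupp.prod,
    zsmul_eq_mul, map_mul]
  simp

theorem coeff_gradedPointValue (f : MvPolynomial (Face n) ℤ) (d : ℕ) :
    (gradedPointValue f).coeff d =
      ∑ m ∈ f.support with m.degree = d, f.coeff m • monomialValue pointValue m := by
  conv_lhs => rw [f.as_sum]
  simp only [map_sum, gradedPointValue_monomial, Polynomial.finsetSum_coeff,
    Polynomial.coeff_monomial, Finset.sum_filter]

/-- Its degree 1 component takes a constant value, which lies in the span of the degree 0 monomial.
-/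
theorem theta_mem_degenerateIdeal (e : Fin n) : theta e ∈ degenerateIdeal n := by
  have h : gradedPointValue (theta e) =
      Polynomial.C (algebraMap ℚ (Equiv.Perm (Fin n) → ℚ) (e + 1)) * Polynomial.X := by
    rw [← aeval_pointValue_theta]
    simp only [theta, map_sum, gradedPointValue, aeval_X, Finset.sum_mul]
  intro d
  rw [h, Polynomial.coeff_C_mul_X]
  split_ifs with hd
  · rw [Algebra.algebraMap_eq_smul_one, ← monomialValue_zero pointValue]
    exact Submodule.smul_mem _ _ (Submodule.subset_span ⟨0, by simp [hd], rfl⟩)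
  · exact zero_mem _

theorem X_mul_X_mem_degenerateIdeal {S T : Face n} (h1 : ¬ S.1 ⊆ T.1) (h2 : ¬ T.1 ⊆ S.1) :
    X S * X T ∈ degenerateIdeal n := by
  have h : gradedPointValue (X S * X T) = 0 := by
    simp only [gradedPointValue, map_mul, aeval_X]
    linear_combination Polynomial.X ^ 2 *
      (Polynomial.C_mul (a := pointValue S) (b := pointValue T)).symm.trans
        (by rw [pointValue_mul_eq_zero S T h1 h2, map_zero])
  intro d
  rw [h]
  simp

/-- The values of the degree d part lie in the span of monomials of degree below d, hence of
standard monomials of degree below d, since straightening never raises degree. Independence of the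
standard monomials makes that part zero. -/
theorem eq_zero_of_mem_degenerateIdeal {f : MvPolynomial (Face n) ℤ}
    (hf : ∀ m ∈ f.support, IsStandard m) (h : f ∈ degenerateIdeal n) : f = 0 := by
  classical
  by_contra hne
  obtain ⟨m, hm⟩ := (Finset.nonempty_iff_ne_empty.2 (support_eq_empty.not.2 hne))
  set v := fun q : {q : Face n →₀ ℕ // IsStandard q} => monomialValue pointValue q.1
  set d := m.degree
  set s : Finset {q : Face n →₀ ℕ // IsStandard q} :=
    (f.support.filter fun m => m.degree = d).subtype IsStandard
  have h1 : (gradedPointValue f).coeff d = ∑ q ∈ s, ((f.coeff q.1 : ℤ) : ℚ) • v q := by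
    rw [coeff_gradedPointValue]
    rw [Finset.sum_subtype_of_mem (fun q => ((f.coeff q : ℤ) : ℚ) • monomialValue pointValue q)
      fun q hq => hf q (Finset.mem_filter.1 hq).1]
    simp only [Int.cast_smul_eq_zsmul]
  have h2 : lowerSpan n d ≤ Submodule.span ℚ (v '' {q | q.1.degree < d}) := by
    refine Submodule.span_le.2 ?_
    rintro _ ⟨q, hq, rfl⟩
    refine Submodule.span_mono ?_ (monomialValue_mem_standardSpan pointValue_mul_eq_zero
      aeval_pointValue_theta (le_refl q.degree))
    rintro _ ⟨q', h3, h4, rfl⟩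
    exact ⟨⟨q', h3⟩, h4.trans_lt hq, rfl⟩
  have h3 : (gradedPointValue f).coeff d ∈ Submodule.span ℚ (v '' {q | q.1.degree = d}) := by
    rw [h1]
    refine Submodule.sum_mem _ fun q hq => Submodule.smul_mem _ _ (Submodule.subset_span ?_)
    rw [Finset.mem_subtype, Finset.mem_filter] at hq
    exact ⟨q, hq.2, rfl⟩
  have h4 : (gradedPointValue f).coeff d = 0 := by
    refine Submodule.disjoint_def.1 (linearIndependent_pointValue.disjoint_span_image
      (s := {q | q.1.degree < d}) (t := {q | q.1.degree = d}) ?_) _ (h2 (h d)) h3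
    exact Set.disjoint_left.2 fun q hq hq' => hq.ne hq'
  rw [h1] at h4
  have h5 := linearIndependent_iff'.1 linearIndependent_pointValue s _ h4 ⟨m, hf m hm⟩
    (by simp [s, d, mem_support_iff.1 hm])
  exact mem_support_iff.1 hm (by exact_mod_cast h5)

/-- The nonempty flats of the free matroid are the nonempty finite subsets. -/
noncomputable def flatEquiv (n : ℕ) : Face n ≃ NonemptyFlat (uniform n n) where
  toFun S := ⟨(S.1 : Set (Fin n)), isFlat_free _, S.2⟩
  invFun F := ⟨(Set.toFinite F.1).toFinset, by simpa using F.2.2⟩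
  left_inv S := Subtype.ext (by simp)
  right_inv F := Subtype.ext (by simp)

/-- The class of the variable of a nonempty subset in the Chow ring. -/
noncomputable def faceClass (S : Face n) : FreeChow n := x ⟨(S.1 : Set (Fin n)), S.2⟩

theorem aeval_faceClass (f : MvPolynomial (Face n) ℤ) :
    aeval faceClass f = Ideal.Quotient.mk (chowIdeal (uniform n n)) (rename (flatEquiv n) f) := by
  have h : (aeval faceClass : _ →ₐ[ℤ] FreeChow n) =
      (Ideal.Quotient.mkₐ ℤ (chowIdeal (uniform n n))).comp (rename (flatEquiv n)) := by
    ext S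
    simp [faceClass, x, flatEquiv]
  exact DFunLike.congr_fun h f

theorem aeval_faceClass_surjective :
    Function.Surjective (aeval faceClass : MvPolynomial (Face n) ℤ →ₐ[ℤ] FreeChow n) := by
  intro a
  obtain ⟨f, rfl⟩ := Ideal.Quotient.mk_surjective a
  exact ⟨rename (flatEquiv n).symm f, by rw [aeval_faceClass, rename_rename]; simp⟩

theorem faceClass_mul_eq_zero (S T : Face n) (h1 : ¬ S.1 ⊆ T.1) (h2 : ¬ T.1 ⊆ S.1) :
    faceClass S * faceClass T = 0 := by
  have h : aeval faceClass (X S * X T : MvPolynomial (Face n) ℤ) = 0 := by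
    rw [aeval_faceClass, Ideal.Quotient.eq_zero_iff_mem]
    refine Ideal.mem_sup_left (Ideal.subset_span ⟨flatEquiv n S, flatEquiv n T, ?_, ?_, by simp⟩)
    · simpa [flatEquiv] using h1
    · simpa [flatEquiv] using h2
  simpa using h

theorem rename_theta (e : Fin n) [DecidablePred fun F : NonemptyFlat (uniform n n) => e ∈ F.1]
    [Fintype (NonemptyFlat (uniform n n))] :
    rename (flatEquiv n) (theta e) = ∑ F : NonemptyFlat (uniform n n) with e ∈ F.1, X F := by
  simp only [theta, map_sum, Finset.sum_filter]
  refine Fintype.sum_equiv (flatEquiv n) _ _ fun S => ?_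
  by_cases h : e ∈ S.1 <;> simp [flatEquiv, h]

theorem aeval_faceClass_theta (e : Fin n) : aeval faceClass (theta e) = 0 := by
  classical
  rw [aeval_faceClass, Ideal.Quotient.eq_zero_iff_mem]
  exact Ideal.mem_sup_right (Ideal.subset_span ⟨e, Set.mem_univ _, rename_theta e⟩)

theorem mem_degenerateIdeal_of_aeval_faceClass_eq_zero {f : MvPolynomial (Face n) ℤ}
    (h : aeval faceClass f = 0) : f ∈ degenerateIdeal n := by
  rw [aeval_faceClass, Ideal.Quotient.eq_zero_iff_mem] at h
  have hle : chowIdeal (uniform n n) ≤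
      (degenerateIdeal n).comap (rename (R := ℤ) (flatEquiv n).symm) := by
    refine sup_le (Ideal.span_le.2 ?_) (Ideal.span_le.2 ?_)
    · rintro _ ⟨F, G, h1, h2, rfl⟩
      rw [SetLike.mem_coe, Ideal.mem_comap, map_mul, rename_X, rename_X]
      refine X_mul_X_mem_degenerateIdeal ?_ ?_
      · simpa [flatEquiv] using h1
      · simpa [flatEquiv] using h2
    · rintro _ ⟨e, _, rfl⟩
      rw [SetLike.mem_coe, Ideal.mem_comap, ← rename_theta, rename_rename]
      simpa using theta_mem_degenerateIdeal e
  simpa [rename_rename] using hle h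

/-- The standard monomials are linearly independent in the Chow ring. -/
theorem eq_zero_of_aeval_faceClass_eq_zero {f : MvPolynomial (Face n) ℤ}
    (hf : ∀ m ∈ f.support, IsStandard m) (h : aeval faceClass f = 0) : f = 0 :=
  eq_zero_of_mem_degenerateIdeal hf (mem_degenerateIdeal_of_aeval_faceClass_eq_zero h)

/-- The standard monomials span the Chow ring. -/
theorem exists_standard_aeval_faceClass_eq (a : FreeChow n) :
    ∃ f : MvPolynomial (Face n) ℤ, (∀ m ∈ f.support, IsStandard m) ∧ aeval faceClass f = a := by
  obtain ⟨g, rfl⟩ := aeval_faceClass_surjective a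
  suffices h : aeval faceClass g ∈ (restrictSupport ℤ {m : Face n →₀ ℕ | IsStandard m}).map
      (aeval faceClass : _ →ₐ[ℤ] FreeChow n).toLinearMap by
    obtain ⟨f, hf, hfg⟩ := h
    exact ⟨f, fun m hm => hf hm, hfg⟩
  rw [g.as_sum, map_sum]
  refine Submodule.sum_mem _ fun m _ => ?_
  rw [aeval_monomial, ← Algebra.smul_def]
  refine Submodule.smul_mem _ _ ?_
  have hm := monomialValue_mem_standardSpan (R := ℤ) (p := fun _ => 0) faceClass_mul_eq_zero
    (fun e => by rw [aeval_faceClass_theta, map_zero]) (le_refl m.degree)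
  refine Submodule.span_le.2 ?_ hm
  rintro _ ⟨q, hq, _, rfl⟩
  refine ⟨monomial q 1, ?_, ?_⟩
  · intro m hm
    rw [Finset.mem_coe] at hm
    rw [Finset.mem_singleton.1 (support_monomial_subset hm)]
    exact hq
  · simp [aeval_monomial, monomialValue]

end ChowBasis

/-! ### Polynomials in the size sums -/

section SizeSums

variable {n : ℕ}

/-- The substitution sending the variable with index `i` to the sum of the `x_S` with
`|S| = i + 1`. -/
noncomputable def sizeSum (n : ℕ) : MvPolynomial (Fin n) ℤ →ₐ[ℤ] MvPolynomial (Face n) ℤ :=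
  aeval fun i : Fin n => ∑ S : Face n with S.1.card = (i : ℕ) + 1, X S

/-- Each flag contains exactly one set of each size from 1 to n. -/
theorem restrict_sizeSum (σ : Equiv.Perm (Fin n)) (f : MvPolynomial (Fin n) ℤ) :
    restrict σ (sizeSum n f) = f := by
  have h : (restrict σ).comp (sizeSum n) = AlgHom.id ℤ _ := by
    ext i : 1
    have : ∀ j : Fin n, (j : ℕ) + 1 = i + 1 ↔ j = i := fun j => by
      rw [add_left_inj, Fin.ext_iff]
    simp only [sizeSum, AlgHom.comp_apply, aeval_X, restrict_sum_X, card_seg, this,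
      AlgHom.id_apply, Finset.filter_eq', Finset.mem_univ, if_true, Finset.sum_singleton]
  exact DFunLike.congr_fun h f

/-- The evaluation of a polynomial in the `Z_i` at the elements `z_i` of the Chow ring. -/
noncomputable def evalSizeSum (n : ℕ) : MvPolynomial (Fin n) ℤ →+* FreeChow n :=
  ((aeval faceClass).comp (sizeSum n)).toRingHom

theorem z_eq_sum_faceClass (l : ℕ) : z n l = ∑ S : Face n with S.1.card = l, faceClass S := by
  classical
  let e : Face n ≃ NonemptySubset n :=
    { toFun := fun S => ⟨(S.1 : Set (Fin n)), S.2⟩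
      invFun := fun F => ⟨(Set.toFinite F.1).toFinset, by simpa using F.2⟩
      left_inv := fun S => Subtype.ext (Finset.ext fun a => by rw [Set.Finite.mem_toFinset]; rfl)
      right_inv := fun F => Subtype.ext (by simp) }
  rw [z, Finset.sum_filter, Finset.sum_filter]
  refine (Fintype.sum_equiv e _ _ fun S => ?_).symm
  simp [e, Set.ncard_coe_finset, faceClass]

theorem evalSizeSum_X (i : Fin n) : evalSizeSum n (X i) = z n (i + 1) := by
  simp [evalSizeSum, sizeSum, z_eq_sum_faceClass]

theorem evalSizeSum_Z {l : ℕ} (h1 : 1 ≤ l) (hl : l ≤ n) : evalSizeSum n (Z n l) = z n l := by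
  obtain ⟨i, rfl⟩ := Nat.exists_eq_add_of_le' h1
  rw [Z, dif_pos (Nat.lt_of_succ_le hl), evalSizeSum_X]

theorem z_mem_range {l : ℕ} (h1 : 1 ≤ l) (hl : l ≤ n) :
    z n l ∈ (evalSizeSum n).range :=
  ⟨Z n l, evalSizeSum_Z h1 hl⟩

theorem range_evalSizeSum_le {T : Subring (FreeChow n)} (h : ∀ l, 1 ≤ l → l ≤ n → z n l ∈ T) :
    (evalSizeSum n).range ≤ T := by
  rintro _ ⟨f, rfl⟩
  induction f using MvPolynomial.induction_on with
  | C a => simp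
  | add p q hp hq =>
    rw [map_add]
    exact add_mem hp hq
  | mul_X p i hp =>
    rw [map_mul]
    refine mul_mem hp ?_
    rw [evalSizeSum_X]
    exact h _ (by omega) (by omega)

end SizeSums

/-! ### The rank-nullity ring of a uniform matroid -/

section Uniform

variable {n : ℕ}

theorem rank_uniform (r : ℕ) (S : Set (Fin n)) : rank (uniform r n) S = min r S.ncard := by
  obtain ⟨I, hI⟩ := (uniform r n).exists_isBasis S (Set.subset_univ S)
  have hr : I.ncard ≤ r := uniform_indep_iff.1 hI.indep
  have hS : I.ncard ≤ S.ncard := Set.ncard_le_ncard hI.subset (Set.toFinite S)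
  have hrank : rank (uniform r n) S = I.ncard := by
    rw [rank, ← hI.encard_eq_eRk, Set.ncard]
  rw [hrank]
  refine le_antisymm (le_min hr hS) (min_le_iff.2 ?_)
  by_contra! hcon
  obtain ⟨e, heS, heI⟩ := Set.exists_mem_notMem_of_ncard_lt_ncard hcon.2 (Set.toFinite I)
  have hins : (uniform r n).Indep (insert e I) := by
    rw [uniform_indep_iff, Set.ncard_insert_of_notMem heI (Set.toFinite I)]
    omega
  have := hI.eq_of_subset_indep hins (Set.subset_insert e I) (Set.insert_subset heS hI.subset)
  exact heI (this ▸ Set.mem_insert e I)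

/-- Rank and nullity add up to the size, and in a uniform matroid the size determines both. -/
theorem y_uniform_eq_z {r l : ℕ} : y (uniform r n) (min r l) (l - min r l) = z n l := by
  classical
  rw [y, z]
  refine Finset.sum_congr (Finset.filter_congr fun S _ => ?_) fun _ _ => rfl
  rw [nullity, rank_uniform]
  omega

theorem y_uniform_eq_z_or_eq_zero (r i j : ℕ) :
    (∃ l, 1 ≤ l ∧ l ≤ n ∧ y (uniform r n) i j = z n l) ∨ y (uniform r n) i j = 0 := by
  classical
  by_cases h : ∃ S : NonemptySubset n,
      rank (uniform r n) S.1 = i ∧ nullity (uniform r n) S.1 = j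
  · obtain ⟨S, rfl, rfl⟩ := h
    refine Or.inl ⟨S.1.ncard, (Set.ncard_pos (Set.toFinite _)).2 S.2, ?_, ?_⟩
    · simpa using Set.ncard_le_card S.1
    · rw [nullity, rank_uniform, y_uniform_eq_z]
  · right
    rw [y]
    refine Finset.sum_eq_zero fun S hS => ?_
    exact absurd ⟨S, (Finset.mem_filter.1 hS).2⟩ h

theorem rankNullityRing_uniform (r n : ℕ) :
    rankNullityRing (uniform r n) = (evalSizeSum n).range := by
  refine le_antisymm (Subring.closure_le.2 ?_) (range_evalSizeSum_le fun l _ hl => ?_)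
  · rintro _ ⟨i, j, _, _, rfl⟩
    rcases y_uniform_eq_z_or_eq_zero (n := n) r i j with ⟨l, h1, hl, h⟩ | h
    · rw [h]
      exact z_mem_range h1 hl
    · rw [h]
      exact zero_mem _
  · exact Subring.subset_closure ⟨min r l, l - min r l, by omega, by omega, y_uniform_eq_z.symm⟩

end Uniform

/-! ### Invariants of the symmetric group -/

section Invariants

variable {n : ℕ}

/-- The permutation of the nonempty finite subsets induced by a permutation of `Fin n`. -/
def mapFace (σ : Equiv.Perm (Fin n)) : Equiv.Perm (Face n) where
  toFun S := ⟨S.1.map σ.toEmbedding, S.2.map⟩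
  invFun S := ⟨S.1.map σ.symm.toEmbedding, S.2.map⟩
  left_inv S := Subtype.ext (by ext; simp)
  right_inv S := Subtype.ext (by ext; simp)

theorem mapFace_subset {σ : Equiv.Perm (Fin n)} {S T : Face n} :
    (mapFace σ S).1 ⊆ (mapFace σ T).1 ↔ S.1 ⊆ T.1 := Finset.map_subset_map

theorem card_mapFace (σ : Equiv.Perm (Fin n)) (S : Face n) :
    (mapFace σ S).1.card = S.1.card := Finset.card_map _

theorem permAct_aeval_faceClass (σ : Equiv.Perm (Fin n)) (f : MvPolynomial (Face n) ℤ) :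
    permAct σ (aeval faceClass f) = aeval faceClass (rename (mapFace σ) f) := by
  have h : (permAct σ).comp (aeval faceClass : _ →ₐ[ℤ] FreeChow n).toRingHom =
      (aeval faceClass : _ →ₐ[ℤ] FreeChow n).toRingHom.comp
        (rename (R := ℤ) (mapFace σ)).toRingHom := by
    refine MvPolynomial.ringHom_ext (fun a => by simp) fun S => ?_
    simp [faceClass, permAct_x, mapFace]
  exact DFunLike.congr_fun h f

theorem rename_mapFace_sizeSum (σ : Equiv.Perm (Fin n)) (f : MvPolynomial (Fin n) ℤ) :
    rename (mapFace σ) (sizeSum n f) = sizeSum n f := by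
  have h : (rename (mapFace σ)).comp (sizeSum n) = sizeSum n := by
    ext i : 1
    simp only [sizeSum, AlgHom.comp_apply, aeval_X, map_sum, Finset.sum_filter]
    refine Fintype.sum_equiv (mapFace σ) _ _ fun S => ?_
    rw [card_mapFace]
    split_ifs <;> simp
  exact DFunLike.congr_fun h f

theorem IsStandard.mapDomain_mapFace {m : Face n →₀ ℕ} (hm : IsStandard m)
    (σ : Equiv.Perm (Fin n)) : IsStandard (m.mapDomain (mapFace σ)) := by
  rw [← Finsupp.equivMapDomain_eq_mapDomain]
  have hmem : ∀ S ∈ (Finsupp.equivMapDomain (mapFace σ) m).support,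
      ∃ T ∈ m.support, mapFace σ T = S := fun S hS =>
    ⟨(mapFace σ).symm S, by simpa using hS, by simp⟩
  refine ⟨fun S hS T hT => ?_, fun S hS => ?_, fun S hS T hT h => ?_⟩
  · obtain ⟨S, hS', rfl⟩ := hmem S hS
    obtain ⟨T, hT', rfl⟩ := hmem T hT
    simpa only [mapFace_subset] using hm.chain S hS' T hT'
  · obtain ⟨S, hS', rfl⟩ := hmem S hS
    simpa [card_mapFace] using hm.lt_card S hS'
  · obtain ⟨S, hS', rfl⟩ := hmem S hS
    obtain ⟨T, hT', rfl⟩ := hmem T hT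
    simpa [card_mapFace] using hm.add_card_lt_card S hS' T hT' (Finset.map_ssubset_map.1 h)

theorem restrict_rename_mapFace (σ : Equiv.Perm (Fin n)) (f : MvPolynomial (Face n) ℤ) :
    restrict σ (rename (mapFace σ) f) = restrict 1 f := by
  have hseg : ∀ i, seg σ i = mapFace σ (seg 1 i) := fun i => Subtype.ext (by
    ext e
    simp only [mem_seg, mapFace, Equiv.coe_fn_mk, Finset.mem_map_equiv]
    rfl)
  have h : (restrict σ).comp (rename (mapFace σ)) = restrict 1 := by
    ext S : 1
    rw [AlgHom.comp_apply, rename_X]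
    by_cases hS : ∃ i, seg 1 i = S
    · obtain ⟨i, rfl⟩ := hS
      rw [← hseg, restrict_X_seg, restrict_X_seg]
    · rw [restrict_X_of_ne (not_exists.1 hS), restrict_X_of_ne fun i hi => ?_]
      rw [hseg, (mapFace σ).apply_eq_iff_eq] at hi
      exact hS ⟨i, hi⟩
  exact DFunLike.congr_fun h f

/-- By uniqueness the standard representative f of an invariant class is invariant. Permutations
move the identity flag to every other flag, so all restrictions of f agree with `restrict 1 f`, and
f has the same class as `sizeSum n (restrict 1 f)`. -/
theorem permInvariants_eq_range (n : ℕ) :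
    permInvariants n = (evalSizeSum n).range := by
  refine le_antisymm (fun a ha => ?_) ?_
  · obtain ⟨f, hf, rfl⟩ := exists_standard_aeval_faceClass_eq a
    have hinv : ∀ σ, rename (mapFace σ) f = f := by
      intro σ
      refine sub_eq_zero.1 (eq_zero_of_aeval_faceClass_eq_zero ?_ ?_)
      · classical
        intro m hm
        rcases Finset.mem_union.1 (support_sub _ _ _ hm) with h | h
        · rw [support_rename_of_injective (mapFace σ).injective, Finset.mem_image] at h
          obtain ⟨m', hm', rfl⟩ := h
          exact (hf m' hm').mapDomain_mapFace σ
        · exact hf m h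
      · rw [map_sub, ← permAct_aeval_faceClass, ha σ, sub_self]
    refine ⟨restrict 1 f, ?_⟩
    have h0 := aeval_eq_zero_of_restrict_eq_zero faceClass_mul_eq_zero
      (f := sizeSum n (restrict 1 f) - f) fun σ => by
        rw [map_sub, restrict_sizeSum, sub_eq_zero]
        conv_rhs => rw [← hinv σ]
        rw [restrict_rename_mapFace]
    rw [map_sub, sub_eq_zero] at h0
    exact h0
  · rintro _ ⟨f, rfl⟩ σ
    change permAct σ (aeval faceClass (sizeSum n f)) = aeval faceClass (sizeSum n f)
    rw [permAct_aeval_faceClass, rename_mapFace_sizeSum]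

end Invariants

/-! ### The relations between the size sums -/

section Relations

variable {n : ℕ}

theorem card_filter_between {α : Type*} [Fintype α] [DecidableEq α] {A B : Finset α}
    (h : Disjoint A B) (k : ℕ) :
    (Finset.univ.filter fun G : Finset α => A ⊆ G ∧ G ⊆ A ∪ B ∧ G.card = A.card + k).card =
      B.card.choose k := by
  rw [← Finset.card_powersetCard]
  refine Finset.card_nbij' (fun G => G \ A) (fun H => A ∪ H) ?_ ?_ ?_ ?_
  · intro G hG
    simp only [Finset.coe_filter, Finset.mem_univ, true_and, Set.mem_ofPred_eq] at hG
    rw [Finset.mem_coe, Finset.mem_powersetCard, Finset.card_sdiff_of_subset hG.1, hG.2.2]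
    exact ⟨sdiff_le_iff.2 hG.2.1, by omega⟩
  · intro H hH
    rw [Finset.mem_coe, Finset.mem_powersetCard] at hH
    simp only [Finset.coe_filter, Finset.mem_univ, true_and, Set.mem_ofPred_eq]
    refine ⟨Finset.subset_union_left, Finset.union_subset_union_right hH.1, ?_⟩
    rw [Finset.card_union_of_disjoint (h.mono_right hH.1), hH.2]
  · intro G hG
    simp only [Finset.coe_filter, Finset.mem_univ, true_and, Set.mem_ofPred_eq] at hG
    exact Finset.union_sdiff_of_subset hG.1
  · intro H hH
    rw [Finset.mem_coe, Finset.mem_powersetCard] at hH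
    exact Finset.union_sdiff_cancel_left (h.mono_right hH.1)

theorem Z_succ (i : Fin n) : Z n (i + 1) = X i := by
  rw [Z, dif_pos i.2]

theorem sum_Icc_eq_sum_fin {M : Type*} [AddCommMonoid M] (f : ℕ → M) {b : ℕ} (hb : 0 < b) :
    ∑ l ∈ Finset.Icc b n, f l = ∑ i with b ≤ ((i : Fin n) : ℕ) + 1, f (i + 1) := by
  symm
  refine Finset.sum_bij (fun i _ => (i : ℕ) + 1) ?_ ?_ ?_ fun _ _ => rfl
  · intro i hi
    simp only [Finset.mem_filter, Finset.mem_univ, true_and] at hi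
    exact Finset.mem_Icc.2 ⟨hi, i.2⟩
  · intro i _ j _ h
    exact Fin.ext (Nat.succ_injective h)
  · intro l hl
    rw [Finset.mem_Icc] at hl
    exact ⟨⟨l - 1, by omega⟩, by simp; omega, by simp; omega⟩

theorem sum_Z_Icc (i : Fin n) :
    ∑ j ∈ Finset.Icc ((i : ℕ) + 1) n, Z n j = ∑ j : Fin n with i ≤ j, X j := by
  rw [sum_Icc_eq_sum_fin _ (Nat.succ_pos _)]
  refine Finset.sum_congr (Finset.filter_congr fun j _ => ?_) fun j _ => Z_succ j
  rw [Fin.le_def]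
  omega

/-- Position `i` of `Fin n` carries the index i + 1, which turns i − a − 1 into i − a in the
binomial coefficient. -/
theorem gen_eq_sum_fin {a b : ℕ} (hab : a < b) :
    gen n a b = Z n a * ∑ i with b ≤ ((i : Fin n) : ℕ) + 1,
      ((i - a : ℕ).choose (b - a - 1) : MvPolynomial (Fin n) ℤ) *
        (∑ j : Fin n with i ≤ j, X j) ^ (b - a) := by
  rw [gen, sum_Icc_eq_sum_fin _ (Nat.zero_lt_of_lt hab)]
  congr 1
  refine Finset.sum_congr rfl fun i _ => ?_
  rw [sum_Z_Icc]
  congr 3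
  omega

/-- The sum over all `F ⊂ G` with `|F| = a` and `|G| = b` of `x_F (∑_{H ⊇ G} x_H)^{b-a}`. -/
noncomputable def orbitRelation (n a b : ℕ) : MvPolynomial (Face n) ℤ :=
  ∑ F : Finset (Fin n) with F.card = a, ∑ G : Finset (Fin n) with F ⊂ G ∧ G.card = b,
    faceVar F * above G ^ (b - a)

/-- Each summand vanishes: in the Chow ring every θ_e is zero, and the basic relation becomes x_F
(∑_{S⊇G} x_S)^{|G∖F|} = 0. -/
theorem aeval_faceClass_orbitRelation (a b : ℕ) : aeval faceClass (orbitRelation n a b) = 0 := by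
  rw [orbitRelation, map_sum]
  refine Finset.sum_eq_zero fun F hF => ?_
  rw [map_sum]
  refine Finset.sum_eq_zero fun G hG => ?_
  simp only [Finset.mem_filter, Finset.mem_univ, true_and] at hF hG
  have h := aeval_eq_zero_of_restrict_eq_zero faceClass_mul_eq_zero
    (restrict_faceVar_mul_prod hG.1)
  rw [map_mul, map_prod] at h
  simp only [map_sub, aeval_faceClass_theta, sub_zero, Finset.prod_const] at h
  rw [Finset.card_sdiff_of_subset hG.1.subset, hF, hG.2] at h
  rw [map_mul, map_pow, h]

/-- The first `a` elements in the order given by a permutation. -/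
def initial (σ : Equiv.Perm (Fin n)) (a : Fin n) : Finset (Fin n) :=
  (Finset.Iio a).map σ.toEmbedding

theorem mem_initial {σ : Equiv.Perm (Fin n)} {a e : Fin n} :
    e ∈ initial σ a ↔ σ.symm e < a := by
  simp only [initial, Finset.mem_map_equiv, Finset.mem_Iio]

theorem card_initial (σ : Equiv.Perm (Fin n)) (a : Fin n) : (initial σ a).card = a := by
  simp [initial]

theorem restrict_faceVar (σ : Equiv.Perm (Fin n)) (a : Fin n) {F : Finset (Fin n)}
    (hF : F.card = a) :
    restrict σ (faceVar F) = if F = initial σ a then Z n a else 0 := by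
  obtain ⟨a, ha⟩ := a
  cases a with
  | zero =>
    obtain rfl := Finset.card_eq_zero.1 hF
    have h0 : initial σ ⟨0, ha⟩ = ∅ := Finset.card_eq_zero.1 (card_initial σ _)
    rw [if_pos h0.symm, faceVar, dif_neg Finset.not_nonempty_empty, map_one]
    rfl
  | succ c =>
    have hne : F.Nonempty := Finset.card_pos.1 (by rw [hF]; exact Nat.succ_pos c)
    have hini : initial σ ⟨c + 1, ha⟩ = (seg σ ⟨c, by omega⟩).1 := by
      ext e
      rw [mem_initial, mem_seg, Fin.lt_def, Fin.le_def]
      exact Nat.lt_succ_iff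
    rw [faceVar, dif_pos hne]
    split_ifs with h
    · have : (⟨F, hne⟩ : Face n) = seg σ ⟨c, by omega⟩ := Subtype.ext (h.trans hini)
      rw [this, restrict_X_seg]
      exact (Z_succ (n := n) ⟨c, by omega⟩).symm
    · refine restrict_X_of_ne fun i hi => h ?_
      have hF' : F = (seg σ i).1 := by rw [hi]
      rw [hF', card_seg] at hF
      rw [hF', hini]
      congr 1
      exact congrArg _ (Fin.ext (Nat.succ_injective hF))

/-- Such a G consists of the first a elements, the element at position i, and any b − a − 1 of the i
− a elements at positions a, …, i − 1. -/
theorem card_filter_max (σ : Equiv.Perm (Fin n)) (a : Fin n) {b : ℕ} (hab : (a : ℕ) < b)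
    (i : Fin n) (hi : b ≤ i + 1) :
    (Finset.univ.filter fun G : Finset (Fin n) => (initial σ a ⊂ G ∧ G.card = b) ∧
      σ i ∈ G ∧ ∀ e ∈ G, σ.symm e ≤ i).card = (i - a : ℕ).choose (b - a - 1) := by
  have hai : a ≤ i := by
    rw [Fin.le_def]
    omega
  have hnot : σ i ∉ initial σ a := by
    rw [mem_initial, Equiv.symm_apply_apply]
    exact not_lt.2 hai
  have hA : (insert (σ i) (initial σ a)).card = a + 1 := by
    rw [Finset.card_insert_of_notMem hnot, card_initial]
  have hdisj : Disjoint (insert (σ i) (initial σ a)) ((Finset.Ico a i).map σ.toEmbedding) := by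
    rw [Finset.disjoint_left]
    intro e he
    rw [Finset.mem_insert, mem_initial] at he
    rw [Finset.mem_map_equiv, Finset.mem_Ico]
    rcases he with rfl | he
    · simp
    · exact fun h => absurd he (not_lt.2 h.1)
  have hcard := card_filter_between hdisj (b - a - 1)
  rw [Finset.card_map, Fin.card_Ico] at hcard
  rw [← hcard]
  congr 1
  refine Finset.filter_congr fun G _ => ?_
  have hunion : ∀ e, e ∈ insert (σ i) (initial σ a) ∪ (Finset.Ico a i).map σ.toEmbedding ↔
      σ.symm e ≤ i := by
    intro e
    rw [Finset.mem_union, Finset.mem_insert, mem_initial, Finset.mem_map_equiv, Finset.mem_Ico,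
      ← Equiv.symm_apply_eq]
    constructor
    · rintro ((h | h) | h)
      · exact h.le
      · exact h.le.trans hai
      · exact h.2.le
    · intro h
      rcases h.eq_or_lt with h | h
      · exact Or.inl (Or.inl h)
      · rcases lt_or_ge (σ.symm e) a with h' | h'
        · exact Or.inl (Or.inr h')
        · exact Or.inr ⟨h', h⟩
  rw [Finset.insert_subset_iff, Finset.subset_iff (s₁ := G)]
  simp only [hunion]
  constructor
  · rintro ⟨⟨h1, h2⟩, h3, h4⟩
    exact ⟨⟨h3, h1.subset⟩, fun e he => h4 e he, by omega⟩
  · rintro ⟨⟨h1, h2⟩, h3, h4⟩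
    exact ⟨⟨h2.ssubset_of_ne fun h => hnot (h ▸ h1), by omega⟩, h1, fun e he => h3 e he⟩

theorem card_le_of_forall_symm_le {σ : Equiv.Perm (Fin n)} {i : Fin n} {G : Finset (Fin n)}
    (h : ∀ e ∈ G, σ.symm e ≤ i) : G.card ≤ i + 1 := by
  rw [← card_seg σ i]
  exact Finset.card_le_card fun e he => mem_seg.2 (h e he)

/-- The right side has a single term, at the last position met by G; this form allows the sums over
G and i to be exchanged. -/
theorem restrict_above_pow (σ : Equiv.Perm (Fin n)) {G : Finset (Fin n)} (hG : G.Nonempty)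
    (k : ℕ) : restrict σ (above G) ^ k =
      ∑ i with σ i ∈ G ∧ ∀ e ∈ G, σ.symm e ≤ i, (∑ j : Fin n with i ≤ j, X j) ^ k := by
  obtain ⟨g, hg, hmax⟩ := G.exists_max_image σ.symm hG
  have : (Finset.univ.filter fun i => σ i ∈ G ∧ ∀ e ∈ G, σ.symm e ≤ i) = {σ.symm g} := by
    ext i
    simp only [Finset.mem_filter, Finset.mem_univ, true_and, Finset.mem_singleton]
    constructor
    · rintro ⟨h1, h2⟩
      refine le_antisymm ?_ (h2 g hg)
      simpa using hmax _ h1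
    · rintro rfl
      exact ⟨by simpa using hg, hmax⟩
  rw [this, Finset.sum_singleton, restrict_above_of_max σ hg hmax]

/-- Only the F that is an initial segment of the flag survives. Grouping the G by their last
position then produces the binomial coefficients. -/
theorem restrict_orbitRelation (σ : Equiv.Perm (Fin n)) {a b : ℕ} (hab : a < b) (hb : b ≤ n) :
    restrict σ (orbitRelation n a b) = gen n a b := by
  obtain ⟨a, rfl⟩ : ∃ a' : Fin n, (a' : ℕ) = a := ⟨⟨a, by omega⟩, rfl⟩
  have h1 : restrict σ (orbitRelation n a b) = Z n a *
      ∑ G : Finset (Fin n) with initial σ a ⊂ G ∧ G.card = b,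
        restrict σ (above G) ^ (b - a : ℕ) := by
    rw [orbitRelation, map_sum, Finset.sum_eq_single (initial σ a)]
    · simp only [map_sum, map_mul, map_pow, restrict_faceVar σ a (card_initial σ a), if_true,
        Finset.mul_sum]
    · intro F hF hne
      simp only [map_sum, map_mul, restrict_faceVar σ a (Finset.mem_filter.1 hF).2, if_neg hne,
        zero_mul, Finset.sum_const_zero]
    · intro h
      exact absurd (by simp [card_initial]) h
  rw [h1, gen_eq_sum_fin hab]
  congr 1
  have h2 : ∀ G ∈ Finset.univ.filter fun G : Finset (Fin n) => initial σ a ⊂ G ∧ G.card = b,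
      restrict σ (above G) ^ (b - a : ℕ) = ∑ i, if σ i ∈ G ∧ ∀ e ∈ G, σ.symm e ≤ i then
        (∑ j : Fin n with i ≤ j, X j) ^ (b - a : ℕ) else 0 := by
    intro G hG
    have hcard := (Finset.mem_filter.1 hG).2.2
    rw [restrict_above_pow σ (Finset.card_pos.1 (by omega)), Finset.sum_filter]
  rw [Finset.sum_congr rfl h2, Finset.sum_comm, Finset.sum_filter]
  refine Finset.sum_congr rfl fun i _ => ?_
  rw [← Finset.sum_filter, Finset.filter_filter, Finset.sum_const]
  split_ifs with hi
  · rw [card_filter_max σ a hab i hi, nsmul_eq_mul]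
  · rw [Finset.card_eq_zero.2, zero_smul]
    refine Finset.filter_eq_empty_iff.2 fun G _ h => hi ?_
    rw [← h.1.2]
    exact card_le_of_forall_symm_le h.2.2

theorem evalSizeSum_gen {a b : ℕ} (hab : a < b) (hb : b ≤ n) : evalSizeSum n (gen n a b) = 0 := by
  have h := aeval_eq_zero_of_restrict_eq_zero faceClass_mul_eq_zero
    (f := sizeSum n (gen n a b) - orbitRelation n a b) fun σ => by
      rw [map_sub, restrict_sizeSum, restrict_orbitRelation σ hab hb, sub_self]
  rw [map_sub, aeval_faceClass_orbitRelation, sub_zero] at h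
  exact h

theorem relIdeal_le_ker (n : ℕ) : relIdeal n ≤ RingHom.ker (evalSizeSum n) := by
  refine Ideal.span_le.2 ?_
  rintro _ ⟨a, b, hab, hb, rfl⟩
  exact evalSizeSum_gen hab hb

end Relations

/-! ### Leading terms and the Gröbner basis -/

section Groebner

variable {n : ℕ}

/-- The exponent of `Z n l`. -/
noncomputable def zExp (n : ℕ) : ℕ → Fin n →₀ ℕ
  | 0 => 0
  | i + 1 => if h : i < n then Finsupp.single ⟨i, h⟩ 1 else 0

theorem zExp_succ (i : Fin n) : zExp n (i + 1) = Finsupp.single i 1 := by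
  rw [zExp, dif_pos i.2]

theorem Z_eq_monomial {l : ℕ} (hl : l ≤ n) : Z n l = monomial (zExp n l) 1 := by
  cases l with
  | zero => rfl
  | succ i =>
    have hi : i < n := hl
    rw [Z, zExp, dif_pos hi, dif_pos hi]
    rfl

/-- The exponent of the leading term of `gen n a b`. -/
noncomputable def genExp (n a b : ℕ) : Fin n →₀ ℕ := zExp n a + (b - a) • zExp n b

theorem Z_mul_Z_pow {a b : ℕ} (hab : a < b) (hb : b ≤ n) :
    Z n a * Z n b ^ (b - a) = monomial (genExp n a b) 1 := by
  rw [Z_eq_monomial hb, Z_eq_monomial (hab.le.trans hb), monomial_pow, monomial_mul, one_pow,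
    one_mul, genExp]

theorem degree_sum_lt {σ ι R : Type*} [CommSemiring R] (m : MonomialOrder σ) {s : Finset ι}
    {f : ι → MvPolynomial σ R} {d : σ →₀ ℕ} (hd : 0 ≺[m] d) (h : ∀ i ∈ s, m.degree (f i) ≺[m] d) :
    m.degree (∑ i ∈ s, f i) ≺[m] d := by
  classical
  induction s using Finset.induction_on with
  | empty => simpa using hd
  | insert i s hi ih =>
    rw [Finset.sum_insert hi]
    refine m.degree_add_le.trans_lt (max_lt (h i (Finset.mem_insert_self i s)) (ih fun j hj => ?_))
    exact h j (Finset.mem_insert_of_mem hj)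

theorem zero_lt_single (m : MonomialOrder (Fin n)) (i : Fin n) :
    0 ≺[m] Finsupp.single i 1 := by
  rw [map_zero, m.toSyn_lt_iff_ne_zero]
  simp

variable {m : MonomialOrder (Fin n)}

theorem leading_tailSum (hm : ∀ i j : Fin n, i < j → Finsupp.single j 1 ≺[m] Finsupp.single i 1)
    (i : Fin n) : m.Monic (∑ j with i ≤ j, (X j : MvPolynomial (Fin n) ℤ)) ∧
      m.degree (∑ j with i ≤ j, (X j : MvPolynomial (Fin n) ℤ)) = Finsupp.single i 1 := by
  have hsplit : ∑ j with i ≤ j, (X j : MvPolynomial (Fin n) ℤ) =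
      X i + ∑ j with i < j, X j := by
    rw [← Finset.add_sum_erase _ _ (a := i) (by simp)]
    congr 1
    refine Finset.sum_congr ?_ fun _ _ => rfl
    ext j
    simp [lt_iff_le_and_ne, and_comm, eq_comm]
  have hlt : m.degree (∑ j with i < j, (X j : MvPolynomial (Fin n) ℤ)) ≺[m]
      m.degree (X i : MvPolynomial (Fin n) ℤ) := by
    rw [m.degree_X]
    refine degree_sum_lt m (zero_lt_single m i) fun j hj => ?_
    rw [m.degree_X]
    exact hm i j (Finset.mem_filter.1 hj).2
  rw [hsplit]
  exact ⟨m.monic_X.add_of_lt hlt, by rw [m.degree_add_of_lt hlt, m.degree_X]⟩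

/-- The i-th tail sum has leading term Z_i, so the summand i = b dominates, and its binomial
coefficient is 1. -/
theorem leading_gen (hm : ∀ i j : Fin n, i < j → Finsupp.single j 1 ≺[m] Finsupp.single i 1)
    {a b : ℕ} (hab : a < b) (hb : b ≤ n) :
    m.Monic (gen n a b) ∧ m.degree (gen n a b) = genExp n a b := by
  obtain ⟨c, rfl⟩ : ∃ c : Fin n, (c : ℕ) + 1 = b := ⟨⟨b - 1, by omega⟩, by simp; omega⟩
  set k := (c : ℕ) + 1 - a
  have hk : k ≠ 0 := by omega
  have hpow : ∀ i : Fin n, m.Monic ((∑ j with i ≤ j, (X j : MvPolynomial (Fin n) ℤ)) ^ k) ∧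
      m.degree ((∑ j with i ≤ j, (X j : MvPolynomial (Fin n) ℤ)) ^ k) =
        k • Finsupp.single i 1 := fun i => by
    obtain ⟨h1, h2⟩ := leading_tailSum hm i
    exact ⟨h1.pow, by rw [m.degree_pow, h2]⟩
  have hgen : gen n a (c + 1) = Z n a * ((∑ j with c ≤ j, X j) ^ k +
      ∑ i with c < i, ((i - a : ℕ).choose (k - 1) : MvPolynomial (Fin n) ℤ) *
        (∑ j with i ≤ j, X j) ^ k) := by
    rw [gen_eq_sum_fin hab, ← Finset.add_sum_erase _ _ (a := c) (by simp)]
    congr 2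
    · have : (c : ℕ) - a = c + 1 - a - 1 := by omega
      rw [this, Nat.choose_self, Nat.cast_one, one_mul]
    · refine Finset.sum_congr ?_ fun _ _ => rfl
      ext i
      simp only [Finset.mem_erase, Finset.mem_filter, Finset.mem_univ, true_and, Fin.lt_def,
        ne_eq, Fin.ext_iff]
      omega
  have hlt : m.degree (∑ i with c < i, ((i - a : ℕ).choose (k - 1) : MvPolynomial (Fin n) ℤ) *
      (∑ j with i ≤ j, X j) ^ k) ≺[m]
      m.degree ((∑ j with c ≤ j, (X j : MvPolynomial (Fin n) ℤ)) ^ k) := by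
    rw [(hpow c).2]
    refine degree_sum_lt m ?_ fun i hi => ?_
    · rw [map_zero, m.toSyn_lt_iff_ne_zero]
      simp [hk]
    · refine m.degree_mul_le.trans_lt ?_
      have hcast : (((i - a : ℕ).choose (k - 1) : ℕ) : MvPolynomial (Fin n) ℤ) =
        C (((i - a : ℕ).choose (k - 1) : ℕ) : ℤ) := by simp
      rw [hcast, m.degree_C, zero_add, (hpow i).2, map_nsmul, map_nsmul]
      exact nsmul_lt_nsmul_right hk (hm c i (Finset.mem_filter.1 hi).2)
  have hQ := (hpow c).1.add_of_lt hlt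
  have hZ : m.Monic (Z n a) := by
    rw [Z_eq_monomial (by omega)]
    exact m.monic_monomial_one
  rw [hgen]
  refine ⟨hZ.mul hQ, ?_⟩
  rw [m.degree_mul hZ.ne_zero hQ.ne_zero, m.degree_add_of_lt hlt, (hpow c).2,
    Z_eq_monomial (by omega), genExp, zExp_succ, m.degree_monomial, if_neg one_ne_zero]

/-- On a flag, a violated standardness condition says that some leading monomial Z_a Z_b^{b-a}
divides q; a = 0 corresponds to the condition on a single exponent. -/
theorem isStandard_mapDomain_seg {q : Fin n →₀ ℕ}
    (hq : ∀ a b, a < b → b ≤ n → ¬ genExp n a b ≤ q) (σ : Equiv.Perm (Fin n)) :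
    IsStandard (q.mapDomain (seg σ)) := by
  classical
  have hmem : ∀ S ∈ (q.mapDomain (seg σ)).support, ∃ i ∈ q.support, seg σ i = S := fun S hS =>
    Finset.mem_image.1 (Finsupp.mapDomain_support hS)
  refine ⟨hasChainSupport_mapDomain σ q, fun S hS => ?_, fun S hS T hT h => ?_⟩
  · obtain ⟨i, -, rfl⟩ := hmem S hS
    rw [Finsupp.mapDomain_apply (seg_injective σ), card_seg]
    by_contra! hle
    refine hq 0 (i + 1) (Nat.succ_pos _) i.2 ?_
    rw [genExp, zExp_succ, zExp, zero_add, Finsupp.smul_single, Finsupp.single_le_iff]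
    simpa using hle
  · obtain ⟨i, -, rfl⟩ := hmem S hS
    obtain ⟨j, hj, rfl⟩ := hmem T hT
    have hji : j < i := by
      refine lt_of_not_ge fun hle => ?_
      exact h.not_subset (seg_subset_seg.2 hle)
    rw [Finsupp.mapDomain_apply (seg_injective σ), card_seg, card_seg]
    by_contra! hle
    have hji' : (j : ℕ) < i := hji
    refine hq (j + 1) (i + 1) (by omega) i.2 fun l => ?_
    have hj1 : 1 ≤ q j := Nat.one_le_iff_ne_zero.2 (Finsupp.mem_support_iff.1 hj)
    rw [genExp, zExp_succ, zExp_succ, Finsupp.smul_single, Finsupp.add_apply,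
      Finsupp.single_apply, Finsupp.single_apply]
    rcases eq_or_ne j l with rfl | h1
    · simpa [hji.ne'] using hj1
    · rcases eq_or_ne i l with rfl | h2
      · rw [if_neg h1, if_pos rfl, smul_eq_mul]
        omega
      · simp [h1, h2]

/-- A reduced polynomial that vanishes at the elements `z_i` of the Chow ring is zero. -/
theorem eq_zero_of_evalSizeSum_eq_zero {r : MvPolynomial (Fin n) ℤ}
    (hr : ∀ q ∈ r.support, ∀ a b, a < b → b ≤ n → ¬ genExp n a b ≤ q)
    (h : evalSizeSum n r = 0) : r = 0 := by
  classical
  -- Discarding the monomials not supported on chains changes neither the restrictions to flags nor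
  -- the class in the Chow ring, and what remains is standard.
  set g : MvPolynomial (Face n) ℤ :=
    ∑ m ∈ (sizeSum n r).support with HasChainSupport m, monomial m ((sizeSum n r).coeff m)
  have hcoeff : ∀ m, HasChainSupport m → g.coeff m = (sizeSum n r).coeff m := by
    intro m hm
    simp only [g, coeff_sum, coeff_monomial, Finset.sum_ite_eq', Finset.mem_filter, hm, and_true]
    rw [ite_eq_left_iff, notMem_support_iff]
    exact Eq.symm
  have hrestrict : ∀ σ, restrict σ g = r := by
    intro σ
    conv_rhs => rw [← restrict_sizeSum σ r]
    ext q
    rw [coeff_restrict, coeff_restrict, hcoeff _ (hasChainSupport_mapDomain σ q)]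
  have hg : g = 0 := by
    refine eq_zero_of_aeval_faceClass_eq_zero (fun m hm => ?_) ?_
    · have hchain : HasChainSupport m := by
        by_contra hcon
        refine mem_support_iff.1 hm ?_
        simp only [g, coeff_sum, coeff_monomial, Finset.sum_ite_eq', Finset.mem_filter, hcon,
          and_false, if_false]
      obtain ⟨σ, q, rfl⟩ := hchain.exists_perm
      refine isStandard_mapDomain_seg (hr q ?_) σ
      rw [mem_support_iff, ← coeff_restrict, hrestrict] at hm
      exact mem_support_iff.2 hm
    · have h0 := aeval_eq_zero_of_restrict_eq_zero faceClass_mul_eq_zero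
        (f := g - sizeSum n r) fun σ => by
          rw [map_sub, hrestrict, restrict_sizeSum, sub_self]
      rw [map_sub, sub_eq_zero] at h0
      exact h0.trans h
  rw [← hrestrict 1, hg, map_zero]

/-- Division of a polynomial in the kernel by the generators leaves no remainder. -/
theorem exists_eq_linearCombination_gen
    (hm : ∀ i j : Fin n, i < j → Finsupp.single j 1 ≺[m] Finsupp.single i 1)
    {f : MvPolynomial (Fin n) ℤ} (hf : evalSizeSum n f = 0) :
    ∃ g : genSet n →₀ MvPolynomial (Fin n) ℤ,
      f = Finsupp.linearCombination _ (fun b : genSet n => (b : MvPolynomial (Fin n) ℤ)) g ∧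
      ∀ b : genSet n, m.degree ((b : MvPolynomial (Fin n) ℤ) * g b) ≼[m] m.degree f := by
  -- Division works over ℤ because the generators are monic.
  obtain ⟨g, r, h1, h2, h3⟩ := m.div_set (B := genSet n) (by
    rintro _ ⟨a, b, hab, hb, rfl⟩
    rw [(leading_gen hm hab hb).1.leadingCoeff_eq_one]
    exact isUnit_one) f
  refine ⟨g, ?_, h2⟩
  have hr : r = 0 := by
    refine eq_zero_of_evalSizeSum_eq_zero (fun q hq a b hab hb => ?_) ?_
    · rw [← (leading_gen hm hab hb).2]
      exact h3 q hq _ ⟨a, b, hab, hb, rfl⟩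
    · have hlc : evalSizeSum n (Finsupp.linearCombination _
          (fun b : genSet n => (b : MvPolynomial (Fin n) ℤ)) g) = 0 := by
        refine relIdeal_le_ker n ?_
        rw [Finsupp.linearCombination_apply]
        exact Submodule.sum_mem _ fun b _ => Ideal.mul_mem_left _ _ (Ideal.subset_span b.2)
      rw [h1, map_add, hlc, zero_add] at hf
      exact hf
  rw [hr, add_zero] at h1
  exact h1

theorem ker_evalSizeSum (n : ℕ) : RingHom.ker (evalSizeSum n) = relIdeal n := by
  refine le_antisymm (fun f hf => ?_) (relIdeal_le_ker n)
  -- The statement involves no monomial order, so any admissible one will do; lex is one.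
  obtain ⟨g, h, -⟩ := exists_eq_linearCombination_gen (m := MonomialOrder.lex)
    (fun i j hij => by
      rw [MonomialOrder.lex_lt_iff]
      exact Finsupp.Lex.single_lt_iff.2 hij) hf
  rw [h, Finsupp.linearCombination_apply]
  exact Submodule.sum_mem _ fun b _ => Ideal.mul_mem_left _ _ (Ideal.subset_span b.2)

theorem finite_genSet (n : ℕ) : (genSet n).Finite := by
  refine ((Set.finite_Iio (n + 1)).image2 (gen n) (Set.finite_Iio (n + 1))).subset ?_
  rintro _ ⟨a, b, hab, hb, rfl⟩
  exact ⟨a, Set.mem_Iio.2 (by omega), b, Set.mem_Iio.2 (by omega), rfl⟩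

/-- In a division without remainder no summand exceeds the degree of f, and one must attain it for
the leading coefficient to be nonzero; the leading monomial of that generator divides that of f. -/
theorem exists_degree_le_of_mem_relIdeal
    (hm : ∀ i j : Fin n, i < j → Finsupp.single j 1 ≺[m] Finsupp.single i 1)
    {f : MvPolynomial (Fin n) ℤ} (hf : f ∈ relIdeal n) (hne : f ≠ 0) :
    ∃ b ∈ genSet n, m.degree b ≤ m.degree f := by
  rw [← ker_evalSizeSum] at hf
  obtain ⟨g, h1, h2⟩ := exists_eq_linearCombination_gen hm hf
  by_contra! hcon
  refine m.coeff_degree_ne_zero_iff.2 hne ?_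
  conv_lhs => arg 2; rw [h1]
  rw [Finsupp.linearCombination_apply, Finsupp.sum, coeff_sum]
  refine Finset.sum_eq_zero fun b _ => ?_
  rw [smul_eq_mul, mul_comm]
  by_cases h0 : (b : MvPolynomial (Fin n) ℤ) * g b = 0
  · rw [h0, coeff_zero]
  · refine m.coeff_eq_zero_of_lt ((h2 b).lt_of_ne fun heq => hcon b b.2 ?_)
    rw [← m.toSyn.injective heq, m.degree_mul' h0]
    exact le_self_add

theorem isGroebnerBasis_genSet
    (hm : ∀ i j : Fin n, i < j → Finsupp.single j 1 ≺[m] Finsupp.single i 1) :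
    IsGroebnerBasis m (genSet n) (relIdeal n) := by
  have hsub : genSet n ⊆ relIdeal n := Ideal.subset_span
  refine ⟨finite_genSet n, hsub, le_antisymm (Ideal.span_mono (Set.image_mono hsub))
    (Ideal.span_le.2 ?_)⟩
  rintro _ ⟨f, hf, rfl⟩
  by_cases hne : f = 0
  · rw [hne, m.leadingTerm_zero]
    exact zero_mem _
  · obtain ⟨b, hb, hle⟩ := exists_degree_le_of_mem_relIdeal hm hf hne
    have hlead : m.leadingCoeff b = 1 := by
      obtain ⟨a, c, hac, hc, rfl⟩ := hb
      exact (leading_gen hm hac hc).1.leadingCoeff_eq_one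
    have heq : m.leadingTerm f =
        monomial (m.degree f - m.degree b) (m.leadingCoeff f) * m.leadingTerm b := by
      rw [MonomialOrder.leadingTerm, MonomialOrder.leadingTerm, hlead, monomial_mul, mul_one,
        tsub_add_cancel_of_le hle]
    rw [heq]
    exact Ideal.mul_mem_left _ _ (Ideal.subset_span ⟨b, hb, rfl⟩)

end Groebner

end RankNullity

theorem mainTheorem5 (r n : ℕ) (hr : r ≤ n) :
    RankNullity.rankNullityRing (RankNullity.uniform r n) = RankNullity.permInvariants n ∧
    (∃ φ : (MvPolynomial (Fin n) ℤ ⧸ RankNullity.relIdeal n) ≃+*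
        RankNullity.rankNullityRing (RankNullity.uniform r n),
      ∀ i : ℕ, 1 ≤ i → i ≤ n →
        (φ (Ideal.Quotient.mk (RankNullity.relIdeal n) (RankNullity.Z n i)) :
          RankNullity.FreeChow n) = RankNullity.z n i) ∧
    ∀ m : MonomialOrder (Fin n),
      (∀ i j : Fin n, i < j → Finsupp.single j 1 ≺[m] Finsupp.single i 1) →
      (∀ a b : ℕ, a < b → b ≤ n →
        m.leadingTerm (RankNullity.gen n a b) =
          RankNullity.Z n a * RankNullity.Z n b ^ (b - a)) ∧
      RankNullity.IsGroebnerBasis m (RankNullity.genSet n) (RankNullity.relIdeal n) := by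
  refine ⟨?_, ?_, fun m hm => ⟨fun a b hab hb => ?_, RankNullity.isGroebnerBasis_genSet hm⟩⟩
  · rw [RankNullity.rankNullityRing_uniform, RankNullity.permInvariants_eq_range]
  · refine ⟨(Ideal.quotEquivOfEq (RankNullity.ker_evalSizeSum n).symm).trans
      ((RingHom.quotientKerEquivRange (RankNullity.evalSizeSum n)).trans
        (RingEquiv.subringCongr (RankNullity.rankNullityRing_uniform r n).symm)),
      fun i h1 hi => ?_⟩
    exact RankNullity.evalSizeSum_Z h1 hi
  · obtain ⟨h1, h2⟩ := RankNullity.leading_gen hm hab hb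
    rw [RankNullity.Z_mul_Z_pow hab hb, MonomialOrder.leadingTerm, h1.leadingCoeff_eq_one, h2]
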